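/- Let $V,W:\mathbb R\to\mathbb R$ be $C^\infty$ functions mapping $[0,1]$ into $[0,1]$, with $V(0)=W(0)=0$, and let $\varepsilon,\delta\ge 1$. (Thus $V|_{[0,1]},W|_{[0,1]}$ are smooth attachment functions; their smooth extension is used only at fixed points on the boundary of the square.) Consider the system $$b'=F_1(b,g)=V(g)-\varepsilon b,\qquad g'=F_2(b,g)=W(b)-\delta g ,$$ and assume that it has only finitely many fixed points (constant solutions) in $[0,1]^2$. Definitions. A fixed point $p$ is classified by the two eigenvalues (with multiplicity) of the linearization $DF(p)$: it is a *stable node* if both are real and negative, a *stable spiral* if both are non-real with negative real part, a *saddle* if they are real, one negative and one positive, *of saddle-node type* if one is $0$ and the other is negative, and *repelling* if both have positive real part. For $k\ge 1$ a *$C^k$ center manifold at $p$* is an arc $M=\gamma((-r,r))$, where $r>0$ and $\gamma:(-r,r)\to\mathbb R^2$ is a $C^k$ embedding with $\gamma'\neq0$ and $\gamma(0)=p$, such that $\gamma'(0)$ spans the center subspace of $DF(p)$ (the sum of the generalized eigenspaces of eigenvalues with real part $0$) and such that every solution starting on $M$ stays on $M$ for small $|t|$. Its *branches* are $\gamma((0,r))$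 and $\gamma((-r,0))$. A branch *converges to $p$* if the trajectory of each of its points near $p$ exists for all $t\ge0$, stays on the branch and tends to $p$ as $t\to+\infty$. A branch *diverges from $p$* if the trajectory of each of its points near $p$ exists for all $t\le0$, stays on the branch for these times and tends to $p$ as $t\to-\infty$, and some neighbourhood of $p$ contains none of the forward trajectories of these points. Theorem. The set of fixed points is $\{(b,g)\in[0,1]^2:\ \varepsilon b=V(g),\ \delta g=W(b)\}$. For every fixed point $p=(b_0,g_0)$ the following hold. 1. $p$ is a stable node, a stable spiral, a saddle, or of saddle-node type. It is not repelling; indeed at least one eigenvalue has negative real part. 2. $p$ is a stable node or a stable spiral if and only if $V'(g_0)W'(b_0)<\varepsilon\delta$. 3. $p$ is a saddle if and only if $V'(g_0)W'(b_0)>\varepsilon\delta$. 4. For every integer $k\ge1$: $p$ lies on a $C^k$ center manifold at $p$ if and only if $V'(g_0)W'(b_0)=\varepsilon\delta$. 5. Each branch, contained in $[0,1]^2$, of any $C^1$ center manifold at $p$ either converges to $p$ or diverges from $p$. 6. If $V'(g_0)W'(b_0)=\varepsilon\delta$ and $V''(g_0)W'(b_0)+\frac1\varepsilon V'(g_0)^2W''(b_0)\neq0$,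 then for every $C^1$ center manifold at $p$ one of its two branches converges to $p$ and the other one diverges from $p$. -/

import Mathlib

open Set Filter Topology Polynomial
open scoped ContDiff

/-- The vector field of the two-sided platform system `b' = V(g) - ε b`, `g' = W(b) - δ g`;
a point of the plane is written `p = (b, g)`. -/
def platformField (V W : ℝ → ℝ) (ε δ : ℝ) (p : ℝ × ℝ) : ℝ × ℝ :=
  (V p.2 - ε * p.1, W p.1 - δ * p.2)

/-- The unit square `[0,1]²`. -/
def unitSquare : Set (ℝ × ℝ) := Icc 0 1 ×ˢ Icc 0 1

/-- The fixed points of the platform system in `[0,1]²`: the points at which the constant curve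
is a solution of the system. -/
def platformFixedPoints (V W : ℝ → ℝ) (ε δ : ℝ) : Set (ℝ × ℝ) :=
  {p | p ∈ unitSquare ∧ IsIntegralCurve (fun _ => p) (fun _ => platformField V W ε δ)}

/-- The linearization of a planar vector field at a point. -/
noncomputable def linearization (F : ℝ × ℝ → ℝ × ℝ) (p : ℝ × ℝ) : (ℝ × ℝ) →ₗ[ℝ] (ℝ × ℝ) :=
  (fderiv ℝ F p).toLinearMap

/-- The complex eigenvalues, with algebraic multiplicity, of the linearization of `F` at `p`. -/
noncomputable def eigenvaluesAt (F : ℝ × ℝ → ℝ × ℝ) (p : ℝ × ℝ) : Multiset ℂ :=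
  (linearization F p).charpoly.aroots ℂ

/-- Stable node: all eigenvalues are real and negative. -/
def IsStableNode (F : ℝ × ℝ → ℝ × ℝ) (p : ℝ × ℝ) : Prop :=
  ∀ μ ∈ eigenvaluesAt F p, μ.im = 0 ∧ μ.re < 0

/-- Stable spiral: the eigenvalues are not real and have negative real part. -/
def IsStableSpiral (F : ℝ × ℝ → ℝ × ℝ) (p : ℝ × ℝ) : Prop :=
  ∀ μ ∈ eigenvaluesAt F p, μ.im ≠ 0 ∧ μ.re < 0

/-- Saddle: one negative and one positive real eigenvalue. -/
def IsSaddle (F : ℝ × ℝ → ℝ × ℝ) (p : ℝ × ℝ) : Prop :=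
  ∃ μ₁ μ₂ : ℝ, μ₁ < 0 ∧ 0 < μ₂ ∧ eigenvaluesAt F p = {(μ₁ : ℂ), (μ₂ : ℂ)}

/-- Degenerate fixed point of saddle-node type: a simple eigenvalue `0`, the other eigenvalue
being negative. -/
def IsSaddleNodeType (F : ℝ × ℝ → ℝ × ℝ) (p : ℝ × ℝ) : Prop :=
  ∃ μ : ℝ, μ < 0 ∧ eigenvaluesAt F p = {(μ : ℂ), (0 : ℂ)}

/-- Repelling: all eigenvalues have positive real part. -/
def IsRepelling (F : ℝ × ℝ → ℝ × ℝ) (p : ℝ × ℝ) : Prop :=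
  ∀ μ ∈ eigenvaluesAt F p, 0 < μ.re

/-- The center subspace of a linear map `A`: the sum of the kernels of `q(A)` over all nonzero
real polynomials `q` whose complex roots all lie on the imaginary axis, that is, the real
subspace whose complexification is the sum of the generalized eigenspaces of the eigenvalues
with real part `0`. -/
noncomputable def centerSubspace (A : (ℝ × ℝ) →ₗ[ℝ] (ℝ × ℝ)) : Submodule ℝ (ℝ × ℝ) :=
  ⨆ q ∈ {q : ℝ[X] | q ≠ 0 ∧ ∀ z ∈ q.aroots ℂ, z.re = 0}, LinearMap.ker (aeval A q)

/-- `IsCenterManifold F p k γ r`: the arc `γ((-r, r))` is a (one-dimensional, local) center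
manifold of class `C^k` of the vector field `F` at `p`. The two branches of the center manifold
are `γ((0, r))` and `γ((-r, 0))`. -/
structure IsCenterManifold (F : ℝ × ℝ → ℝ × ℝ) (p : ℝ × ℝ) (k : ℕ) (γ : ℝ → ℝ × ℝ) (r : ℝ) :
    Prop where
  pos : 0 < r
  contDiffOn : ContDiffOn ℝ k γ (Ioo (-r) r)
  deriv_ne_zero : ∀ s ∈ Ioo (-r) r, deriv γ s ≠ 0
  isEmbedding : IsEmbedding ((Ioo (-r) r).domRestrict γ)
  through : γ 0 = p
  /-- The tangent line at `p` is the center subspace of the linearization. -/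
  tangent : Submodule.span ℝ {deriv γ 0} = centerSubspace (linearization F p)
  /-- Local invariance: every solution that starts on the arc stays on it for small times. -/
  invariant : ∀ s ∈ Ioo (-r) r, ∀ x : ℝ → ℝ × ℝ, IsIntegralCurveAt x (fun _ => F) 0 →
    x 0 = γ s → ∀ᶠ t in 𝓝 0, x t ∈ γ '' Ioo (-r) r

/-- The branch `β((0, r))` converges to `p`: the trajectory of each of its points near `p` exists
for all `t ≥ 0`, stays on the branch and tends to `p` as `t → ∞`. -/
def BranchConverges (F : ℝ × ℝ → ℝ × ℝ) (p : ℝ × ℝ) (β : ℝ → ℝ × ℝ) (r : ℝ) : Prop :=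
  ∃ ρ ∈ Ioc 0 r, ∀ s ∈ Ioo 0 ρ, ∃ x : ℝ → ℝ × ℝ,
    IsIntegralCurveOn x (fun _ => F) (Ici 0) ∧ x 0 = β s ∧
    (∀ t ∈ Ici (0 : ℝ), x t ∈ β '' Ioo 0 r) ∧ Tendsto x atTop (𝓝 p)

/-- The branch `β((0, r))` diverges from `p`: the trajectory of each of its points near `p` exists
for all `t ≤ 0`, stays on the branch for these times and tends to `p` as `t → -∞`, and forwards
in time all these trajectories leave a fixed neighbourhood of `p`. -/
def BranchDiverges (F : ℝ × ℝ → ℝ × ℝ) (p : ℝ × ℝ) (β : ℝ → ℝ × ℝ) (r : ℝ) : Prop :=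
  ∃ ρ ∈ Ioc 0 r,
    (∀ s ∈ Ioo 0 ρ, ∃ x : ℝ → ℝ × ℝ,
      IsIntegralCurveOn x (fun _ => F) (Iic 0) ∧ x 0 = β s ∧
      (∀ t ∈ Iic (0 : ℝ), x t ∈ β '' Ioo 0 r) ∧ Tendsto x atBot (𝓝 p)) ∧
    ∃ N ∈ 𝓝 p, ∀ s ∈ Ioo 0 ρ, ∀ x : ℝ → ℝ × ℝ,
      IsIntegralCurveOn x (fun _ => F) (Ici 0) → x 0 = β s → ∃ t ∈ Ici (0 : ℝ), x t ∉ N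

/-! The linearization at a fixed point has matrix `[-ε, α; β, -δ]` with `α = V'(g₀)`, `β = W'(b₀)`.
Its trace `-(ε + δ)` is negative, so some eigenvalue has negative real part, and the sign of the
determinant `εδ - αβ` decides the type. The center subspace is zero unless `αβ = εδ`, when it is
spanned by `(α, ε)`; since the tangent of a center manifold is nonzero, this equality is necessary
for one to exist.

It is also sufficient. In the eigenbasis `(α, ε)`, `(α, -δ)`, after rescaling and cutting off, the
system reads `u' = f(u, y)`, `y' = -lam y + h(u, y)` with `lam = ε + δ` and `f`, `h` small with
finitely many derivatives. A graph `y = φ(u)` is invariant if and only if `f φ' + lam φ = h`. This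
first-order equation is discretised implicitly with step `τ`: the factor `(1 + τ lam)⁻¹` beats the
growth `1 + O(τ η)` of derivatives under a near-identity substitution, so a ball of `C^(K+1)` is
preserved, while the map contracts in the sup norm (`exists_approx_fixed_graphStep`). Approximate
fixed points solve the equation up to `O(τ)`. The maximum principle `le_of_abs_transport_le` makes
them uniformly Cauchy as `τ → 0`, and Landau's inequality passes derivatives to the limit
(`exists_invariant_graph`).

For the dynamics, invariance of a `C¹` arc forces `F(γ(s)) = a(s) γ'(s)` with `a` continuous and
`a(s) = O(s)` (`exists_smul_deriv`, `exists_speed`). A branch thus carries the scalar equation `s' =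
a(s)`. Finiteness of the fixed points keeps `a` away from zero near the end of a branch in the
square, so its sign is constant there and decides between convergence and divergence. In the
nondegenerate case, pairing the field with a left null vector of the linearization shows that
`a(s)/s²` has a nonzero limit. Then `a` has the same sign on both sides of `p`, and the two branches
behave oppositely. -/

/-! ### Calculus of uniform derivative bounds -/

/-- `f` is of class `C^n` and its derivatives of order `0, …, n` are bounded by `C`. -/
def BddDerivs (n : ℕ) (C : ℝ) (f : ℝ → ℝ) : Prop :=
  ContDiff ℝ n f ∧ ∀ i ≤ n, ∀ x, |iteratedDeriv i f x| ≤ C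

namespace BddDerivs

variable {n : ℕ} {C D : ℝ} {f g : ℝ → ℝ}

theorem abs_le (h : BddDerivs n C f) (x : ℝ) : |f x| ≤ C := by
  simpa using h.2 0 (Nat.zero_le _) x

theorem nonneg (h : BddDerivs n C f) : 0 ≤ C := (abs_nonneg _).trans (h.abs_le 0)

theorem zero_iff : BddDerivs 0 C f ↔ Continuous f ∧ ∀ x, |f x| ≤ C := by
  simp [BddDerivs]

theorem succ_iff : BddDerivs (n + 1) C f ↔
    Differentiable ℝ f ∧ (∀ x, |f x| ≤ C) ∧ BddDerivs n C (deriv f) := by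
  have key : ContDiff ℝ ((n + 1 : ℕ) : WithTop ℕ∞) f ↔
      Differentiable ℝ f ∧ ContDiff ℝ (n : WithTop ℕ∞) (deriv f) := by
    have := contDiff_succ_iff_deriv (𝕜 := ℝ) (n := (n : WithTop ℕ∞)) (f := f)
    simpa using this
  constructor
  · rintro ⟨h1, h2⟩
    refine ⟨(key.1 h1).1, fun x => by simpa using h2 0 (Nat.zero_le _) x, (key.1 h1).2, ?_⟩
    intro i hi x
    rw [← iteratedDeriv_succ']
    exact h2 (i + 1) (by omega) x
  · rintro ⟨h1, h2, h3, h4⟩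
    refine ⟨key.2 ⟨h1, h3⟩, ?_⟩
    rintro (_ | i) hi x
    · simpa using h2 x
    · rw [iteratedDeriv_succ']
      exact h4 i (by omega) x

theorem of_le {m : ℕ} (h : BddDerivs n C f) (hm : m ≤ n) (hC : C ≤ D) : BddDerivs m D f :=
  ⟨h.1.of_le (by exact_mod_cast hm), fun i hi x => (h.2 i (hi.trans hm) x).trans hC⟩

theorem add (hf : BddDerivs n C f) (hg : BddDerivs n D g) :
    BddDerivs n (C + D) (fun x => f x + g x) := by
  refine ⟨hf.1.add hg.1, fun i hi x => ?_⟩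
  have e : iteratedDeriv i (fun x => f x + g x) x = iteratedDeriv i f x + iteratedDeriv i g x :=
    iteratedDeriv_fun_add (hf.1.contDiffAt.of_le (by exact_mod_cast hi))
      (hg.1.contDiffAt.of_le (by exact_mod_cast hi))
  rw [e]
  exact (abs_add_le _ _).trans (add_le_add (hf.2 i hi x) (hg.2 i hi x))

theorem const_mul (hf : BddDerivs n C f) (c : ℝ) : BddDerivs n (|c| * C) (fun x => c * f x) := by
  refine ⟨contDiff_const.mul hf.1, fun i hi x => ?_⟩
  rw [iteratedDeriv_const_mul_field, abs_mul]
  exact mul_le_mul_of_nonneg_left (hf.2 i hi x) (abs_nonneg c)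

theorem mul (hf : BddDerivs n C f) (hg : BddDerivs n D g) :
    BddDerivs n (2 ^ n * (C * D)) (fun x => f x * g x) := by
  induction n generalizing f g with
  | zero =>
    rw [zero_iff] at *
    refine ⟨hf.1.mul hg.1, fun x => ?_⟩
    rw [abs_mul, pow_zero, one_mul]
    exact mul_le_mul (hf.2 x) (hg.2 x) (abs_nonneg _) ((abs_nonneg _).trans (hf.2 x))
  | succ n ih =>
    have hf' := succ_iff.1 hf
    have hg' := succ_iff.1 hg
    have hC := hf.nonneg
    have hD := hg.nonneg
    refine succ_iff.2 ⟨hf'.1.mul hg'.1, fun x => ?_, ?_⟩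
    · rw [abs_mul]
      calc |f x| * |g x| ≤ 1 * (C * D) := by
            rw [one_mul]; exact mul_le_mul (hf.abs_le x) (hg.abs_le x) (abs_nonneg _) hC
        _ ≤ _ := mul_le_mul_of_nonneg_right (one_le_pow₀ (by norm_num)) (by positivity)
    · have e : deriv (fun x => f x * g x) = fun x => deriv f x * g x + f x * deriv g x := by
        funext x
        exact deriv_fun_mul (hf'.1 x) (hg'.1 x)
      rw [e]
      refine ((ih hf'.2.2 (hg.of_le (Nat.le_succ n) le_rfl)).add
        (ih (hf.of_le (Nat.le_succ n) le_rfl) hg'.2.2)).of_le le_rfl ?_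
      rw [pow_succ]; linarith

theorem lipschitz (h : BddDerivs (n + 1) C f) (x y : ℝ) : |f x - f y| ≤ C * |x - y| := by
  have h' := succ_iff.1 h
  have := convex_univ.norm_image_sub_le_of_norm_deriv_le (f := f) (C := C)
    (fun x _ => h'.1 x) (fun x _ => h'.2.2.abs_le x) (mem_univ y) (mem_univ x)
  simpa [Real.norm_eq_abs] using this

/-- A near-identity substitution `x ↦ x - τ a(x)` changes the derivative bounds by a factor
`1 + O(τ η)`. -/
theorem exists_comp_sub_mul (n : ℕ) : ∃ A : ℝ, 0 ≤ A ∧ ∀ (C η τ : ℝ) (φ a : ℝ → ℝ),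
    BddDerivs n C φ → BddDerivs n η a → η ≤ 1 → 0 ≤ τ → τ ≤ 1 →
    BddDerivs n (C * (1 + A * (τ * η))) (fun x => φ (x - τ * a x)) := by
  induction n with
  | zero =>
    refine ⟨0, le_rfl, fun C η τ φ a hφ ha _ _ _ => ?_⟩
    rw [zero_iff] at *
    refine ⟨hφ.1.comp (continuous_id.sub (continuous_const.mul ha.1)), fun x => ?_⟩
    simpa using hφ.2 _
  | succ n ih =>
    obtain ⟨A, hA, ih⟩ := ih
    -- The derivative is `φ'(x - τ a) - τ φ'(x - τ a) a'`. The first term costs `A` by induction;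
    -- the second costs the product constant `2 ^ n` times `1 + A τ η ≤ 1 + A`.
    refine ⟨A + 2 ^ n * (1 + A), by positivity, fun C η τ φ a hφ ha hη hτ hτ1 => ?_⟩
    have hφ' := succ_iff.1 hφ
    have ha' := succ_iff.1 ha
    have hC := hφ.nonneg
    have hη0 := ha.nonneg
    have h1 := ih C η τ (deriv φ) a hφ'.2.2 (ha.of_le (Nat.le_succ n) le_rfl) hη hτ hτ1
    have h2 := (h1.mul ha'.2.2).const_mul (-τ)
    have hd : ∀ x, HasDerivAt (fun x => φ (x - τ * a x))
        (deriv φ (x - τ * a x) * (1 - τ * deriv a x)) x := fun x =>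
      ((hφ'.1 _).hasDerivAt).comp x
        ((hasDerivAt_id x).sub ((ha'.1 x).hasDerivAt.const_mul τ))
    refine succ_iff.2 ⟨fun x => (hd x).differentiableAt, fun x => ?_, ?_⟩
    · refine (hφ.abs_le _).trans ?_
      have : 0 ≤ (A + 2 ^ n * (1 + A)) * (τ * η) := by positivity
      nlinarith
    · have e : deriv (fun x => φ (x - τ * a x)) = fun x => deriv φ (x - τ * a x) +
          -τ * (deriv φ (x - τ * a x) * deriv a x) := by
        funext x
        rw [(hd x).deriv]; ring
      rw [e]
      refine (h1.add h2).of_le le_rfl ?_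
      rw [abs_neg, abs_of_nonneg hτ]
      have h3 : A * (τ * η) ≤ A := mul_le_of_le_one_right hA (mul_le_one₀ hτ1 hη0 hη)
      have h4 : τ * (2 ^ n * (C * (1 + A * (τ * η)) * η)) ≤ 2 ^ n * (C * (1 + A) * (τ * η)) := by
        have : C * (1 + A * (τ * η)) * (τ * η) ≤ C * (1 + A) * (τ * η) := by gcongr
        have := mul_le_mul_of_nonneg_left this (by positivity : (0 : ℝ) ≤ 2 ^ n)
        linarith
      linarith

/-- Landau's inequality. -/
theorem abs_deriv_le {S h : ℝ} (hf : BddDerivs 2 C f) (hS : ∀ x, |f x| ≤ S) (hh : 0 < h) (x : ℝ) :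
    |deriv f x| ≤ 2 * S / h + C * h := by
  have hf' := succ_iff.1 hf
  obtain ⟨c, hc, hc'⟩ := exists_deriv_eq_slope f (show x < x + h by linarith)
    hf'.1.continuous.continuousOn hf'.1.differentiableOn
  have h1 : |deriv f x - deriv f c| ≤ C * h := by
    refine (hf'.2.2.lipschitz x c).trans (mul_le_mul_of_nonneg_left ?_ hf.nonneg)
    rw [abs_sub_comm, abs_of_pos (by linarith [hc.1])]
    linarith [hc.2]
  have h2 : |deriv f c| ≤ 2 * S / h := by
    rw [hc', abs_div, add_sub_cancel_left, abs_of_pos hh]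
    gcongr
    have := abs_sub (f (x + h)) (f x)
    linarith [hS (x + h), hS x]
  have := abs_sub_abs_le_abs_sub (deriv f x) (deriv f c)
  linarith

/-- A uniform limit of functions with `n + 2` uniformly bounded derivatives has `n + 1`
derivatives, with the same bounds, and the first derivatives converge. -/
theorem of_tendstoUniformly {φ : ℕ → ℝ → ℝ} (hφ : ∀ m, BddDerivs (n + 1) C (φ m))
    (hlim : TendstoUniformly φ f atTop) :
    BddDerivs n C f ∧ (1 ≤ n → ∀ x, Tendsto (fun m => deriv (φ m) x) atTop (𝓝 (deriv f x))) := by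
  have hb : ∀ x, |f x| ≤ C := fun x =>
    le_of_tendsto (hlim.tendsto_at x).abs (Eventually.of_forall fun m => (hφ m).abs_le x)
  induction n generalizing f φ with
  | zero =>
    exact ⟨zero_iff.2 ⟨hlim.continuous (Eventually.of_forall fun m => (hφ m).1.continuous).frequently,
      hb⟩, fun h => by omega⟩
  | succ n ih =>
    have hC := (hφ 0).nonneg
    have hcau : ∀ e > 0, ∃ N, ∀ m ≥ N, ∀ k ≥ N, ∀ x, |deriv (φ m) x - deriv (φ k) x| ≤ e := by
      intro e he
      -- A difference of two terms has derivative bound `2C`. Landau's inequality with `S = e h / 4`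
      -- gives `e / 2 + 2 C h`, and this `h` makes the second summand at most `e / 2`.
      set h : ℝ := e / (4 * (C + 1)) with hh
      have hhpos : 0 < h := by positivity
      have he2 : 0 < e * h / 8 := by positivity
      obtain ⟨N, hN⟩ := eventually_atTop.1 (Metric.tendstoUniformly_iff.1 hlim _ he2)
      refine ⟨N, fun m hm k hk x => ?_⟩
      have hbd : BddDerivs 2 (C + |(-1 : ℝ)| * C) (fun x => φ m x + -1 * φ k x) :=
        ((hφ m).of_le (by omega) le_rfl).add (((hφ k).of_le (by omega) le_rfl).const_mul (-1))
      have hS : ∀ x, |φ m x + -1 * φ k x| ≤ e * h / 4 := fun x => by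
        have h1 := hN m hm x
        have h2 := hN k hk x
        rw [Real.dist_eq, abs_lt] at h1 h2
        rw [_root_.abs_le]
        constructor <;> linarith [h1.1, h1.2, h2.1, h2.2]
      have := hbd.abs_deriv_le hS hhpos x
      have ed : deriv (fun x => φ m x + -1 * φ k x) x = deriv (φ m) x - deriv (φ k) x := by
        have d1 := ((succ_iff.1 (hφ m)).1 x).hasDerivAt
        have d2 := ((succ_iff.1 (hφ k)).1 x).hasDerivAt
        rw [(d1.fun_add (d2.const_mul (-1))).deriv]; ring
      rw [ed] at this
      refine this.trans ?_
      rw [abs_neg, abs_one]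
      have e1 : 2 * (e * h / 4) / h = e / 2 := by field_simp; norm_num
      have e2 : (C + 1) * h = e / 4 := by rw [hh]; field_simp
      rw [e1]
      nlinarith
    have hpt : ∀ x, ∃ y, Tendsto (fun m => deriv (φ m) x) atTop (𝓝 y) := fun x => by
      refine cauchySeq_tendsto_of_complete (Metric.cauchySeq_iff'.2 fun e he => ?_)
      obtain ⟨N, hN⟩ := hcau (e / 2) (by positivity)
      refine ⟨N, fun m hm => ?_⟩
      rw [Real.dist_eq]
      linarith [hN m hm N le_rfl x]
    choose g hg using hpt
    have hunif : TendstoUniformly (fun m => deriv (φ m)) g atTop := by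
      refine Metric.tendstoUniformly_iff.2 fun e he => ?_
      obtain ⟨N, hN⟩ := hcau (e / 2) (by positivity)
      filter_upwards [eventually_ge_atTop N] with m hm x
      rw [Real.dist_eq]
      have : |g x - deriv (φ m) x| ≤ e / 2 :=
        le_of_tendsto ((hg x).sub_const _).abs
          ((eventually_ge_atTop N).mono fun k hk => hN k hk m hm x)
      linarith
    have hder : ∀ x, HasDerivAt f (g x) x := fun x =>
      hasDerivAt_of_tendstoUniformly hunif
        (Eventually.of_forall fun m x => ((succ_iff.1 (hφ m)).1 x).hasDerivAt)
        (fun x => hlim.tendsto_at x) x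
    have hdg : deriv f = g := funext fun x => (hder x).deriv
    have hbg : ∀ x, |g x| ≤ C := fun x =>
      le_of_tendsto (hg x).abs
        (Eventually.of_forall fun m => (succ_iff.1 (hφ m)).2.2.abs_le x)
    refine ⟨succ_iff.2 ⟨fun x => (hder x).differentiableAt, hb, ?_⟩, fun _ x => ?_⟩
    · rw [hdg]
      exact (ih (fun m => (succ_iff.1 (hφ m)).2.2) hunif hbg).1
    · rw [hdg]; exact hg x

/-- Derivative bounds of a composition, small if those of the outer function are small. -/
theorem exists_comp (n : ℕ) (D : ℝ) : ∃ M : ℝ, 0 ≤ M ∧ ∀ (η : ℝ) (v x : ℝ → ℝ),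
    ContDiff ℝ n v → ContDiff ℝ n x → (∀ i ≤ n, ∀ u, |iteratedDeriv i v (x u)| ≤ η) →
    (∀ i, 1 ≤ i → i ≤ n → ∀ u, |iteratedDeriv i x u| ≤ D) →
    BddDerivs n (M * η) (fun u => v (x u)) := by
  -- The Faà di Bruno estimate wants the `j`-th inner derivative bounded by `E ^ j`; having `E ≥ 1`
  -- gives `D ≤ E ≤ E ^ j` for `j ≥ 1`.
  set E := max 1 D with hE
  have hE1 : 1 ≤ E := le_max_left _ _
  refine ⟨n.factorial * E ^ n, by positivity, fun η v x hv hx hvb hxb => ⟨hv.comp hx, ?_⟩⟩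
  intro i hi u
  have hη : 0 ≤ η := (abs_nonneg _).trans (hvb 0 (Nat.zero_le _) 0)
  have := norm_iteratedFDeriv_comp_le hv hx (by exact_mod_cast hi : (i : WithTop ℕ∞) ≤ n) u (C := η)
    (D := E) (fun j hj => by
      rw [norm_iteratedFDeriv_eq_norm_iteratedDeriv]; exact hvb j (hj.trans hi) u)
    (fun j hj1 hj => by
      rw [norm_iteratedFDeriv_eq_norm_iteratedDeriv]
      exact ((hxb j hj1 (hj.trans hi) u).trans (le_max_right _ _)).trans
        (le_self_pow₀ hE1 (by omega)))
  rw [norm_iteratedFDeriv_eq_norm_iteratedDeriv] at this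
  refine this.trans ?_
  have h1 : (i.factorial : ℝ) ≤ n.factorial := by exact_mod_cast Nat.factorial_le hi
  have h2 : E ^ i ≤ E ^ n := pow_le_pow_right₀ hE1 hi
  calc (i.factorial : ℝ) * η * E ^ i ≤ n.factorial * η * E ^ n := by gcongr
    _ = _ := by ring

end BddDerivs

theorem BddDerivs.abs_taylor_le {C : ℝ} {f : ℝ → ℝ} (h : BddDerivs 2 C f) (x k : ℝ) :
    |f (x + k) - f x - k * deriv f x| ≤ C * k ^ 2 := by
  have h' := BddDerivs.succ_iff.1 h
  have hd : ∀ y, HasDerivAt (fun y => f y - y * deriv f x) (deriv f y - deriv f x) y := fun y =>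
    ((h'.1 y).hasDerivAt).sub (by simpa using (hasDerivAt_id y).mul_const (deriv f x))
  have := (convex_uIcc x (x + k)).norm_image_sub_le_of_norm_hasDerivWithin_le
    (f := fun y => f y - y * deriv f x) (C := C * |k|)
    (fun y _ => (hd y).hasDerivWithinAt) (fun y hy => by
      refine (h'.2.2.lipschitz y x).trans (mul_le_mul_of_nonneg_left ?_ h.nonneg)
      have := abs_sub_left_of_mem_uIcc hy
      simpa using this) left_mem_uIcc right_mem_uIcc
  rw [Real.norm_eq_abs, Real.norm_eq_abs, add_sub_cancel_left, mul_assoc, abs_mul_abs_self] at this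
  calc _ = |f (x + k) - (x + k) * deriv f x - (f x - x * deriv f x)| := by congr 1; ring
    _ ≤ _ := by rw [pow_two]; exact this

/-! ### Maximum principle and invariant graphs -/

/-- A maximum principle on the line: a bounded function `d` satisfies `d ≤ M / (lam - θ)` if
`|a d' + lam d| ≤ M + θ |d|` with `a` bounded and `θ < lam`. -/
theorem le_of_abs_transport_le {a d : ℝ → ℝ} {lam S B M θ : ℝ} (hd : Differentiable ℝ d)
    (hS : ∀ u, d u ≤ S) (hB : ∀ u, |a u| ≤ B) (hM : 0 ≤ M) (hθ : θ < lam)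
    (h : ∀ u, |a u * deriv d u + lam * d u| ≤ M + θ * |d u|) (u : ℝ) :
    d u ≤ M / (lam - θ) := by
  have hθ' : 0 < lam - θ := sub_pos.2 hθ
  have hB0 : 0 ≤ B := (abs_nonneg _).trans (hB 0)
  -- A linearly growing penalty of slope at most one: `d - κ p` attains its maximum, where `|d'| ≤
  -- κ`, so the transport term costs only `B κ`. Then `κ → 0`.
  set p : ℝ → ℝ := fun u => √(1 + u ^ 2) with hp
  have hp1 : ∀ u, |u| ≤ p u := fun u => Real.abs_le_sqrt (by linarith)
  have hppos : ∀ u, 0 < p u := fun u => Real.sqrt_pos.2 (by positivity)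
  have hpd : ∀ u, HasDerivAt p (u / p u) u := fun u => by
    have h1 : HasDerivAt (fun u : ℝ => 1 + u ^ 2) (2 * u) u := by
      simpa using (hasDerivAt_pow 2 u).const_add 1
    have := h1.sqrt (by positivity)
    refine this.congr_deriv ?_
    rw [mul_div_mul_left _ _ two_ne_zero]
  have key : ∀ κ > 0, d u ≤ M / (lam - θ) + κ * (p u + B / (lam - θ)) := by
    intro κ hκ
    have hcont : Continuous fun u => d u - κ * p u :=
      hd.continuous.sub (continuous_const.mul (by fun_prop))
    have htend : Tendsto (fun u => d u - κ * p u) (cocompact ℝ) atBot := by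
      have hlin : Tendsto (fun u : ℝ => S + -κ * ‖u‖) (cocompact ℝ) atBot :=
        tendsto_atBot_add_const_left _ _
          ((tendsto_norm_cocompact_atTop (E := ℝ)).const_mul_atTop_of_neg (neg_neg_of_pos hκ))
      refine tendsto_atBot_mono (fun u => ?_) hlin
      have := mul_le_mul_of_nonneg_left (hp1 u) hκ.le
      rw [Real.norm_eq_abs]
      linarith [hS u]
    obtain ⟨v, hv⟩ := hcont.exists_forall_ge htend
    have hv0 : deriv d v = κ * (v / p v) := by
      have hmax : IsLocalMax (fun u => d u - κ * p u) v := Eventually.of_forall hv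
      have := hmax.hasDerivAt_eq_zero ((hd v).hasDerivAt.sub ((hpd v).const_mul κ))
      linarith
    have hv1 : |deriv d v| ≤ κ := by
      rw [hv0, abs_mul, abs_of_pos hκ, abs_div, abs_of_pos (hppos v)]
      exact mul_le_of_le_one_right hκ.le ((div_le_one (hppos v)).2 (hp1 v))
    have hu := hv u
    have hpv := mul_pos hκ (hppos v)
    have hmain : d v ≤ (M + B * κ) / (lam - θ) := by
      rcases le_or_gt (d v) 0 with hneg | hpos
      · exact hneg.trans (by positivity)
      · rw [le_div_iff₀ hθ']
        have h1 := (abs_le.1 (h v)).2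
        rw [abs_of_pos hpos] at h1
        have h2 : |a v * deriv d v| ≤ B * κ := by
          rw [abs_mul]; exact mul_le_mul (hB v) hv1 (abs_nonneg _) hB0
        have := (abs_le.1 h2).1
        linarith
    have e : (M + B * κ) / (lam - θ) = M / (lam - θ) + κ * (B / (lam - θ)) := by
      rw [add_div]; ring
    linarith
  have hc : 0 < p u + B / (lam - θ) := add_pos_of_pos_of_nonneg (hppos u) (by positivity)
  refine le_of_forall_pos_le_add fun e he => ?_
  have := key (e / (p u + B / (lam - θ))) (by positivity)
  rwa [div_mul_cancel₀ _ hc.ne'] at this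

/-- One step of the time-`τ` implicit discretisation of the graph transform of the system
`u' = f(u, y)`, `y' = -lam y + h(u, y)`. -/
noncomputable def graphStep (f h : ℝ → ℝ → ℝ) (lam τ : ℝ) (φ : ℝ → ℝ) (u : ℝ) : ℝ :=
  (1 + τ * lam)⁻¹ * (φ (u - τ * f u (φ u)) + τ * h u (φ u))

/-- The step preserves the unit ball of `C^(K+1)` but contracts only in the sup norm, so an exact
fixed point might lose a derivative. Iterating from zero until the increments drop below `τ ^ 2`
keeps full regularity, which suffices for the limit `τ → 0`. -/
theorem exists_approx_fixed_graphStep {K : ℕ} {f h : ℝ → ℝ → ℝ} {lam η A : ℝ} (hlam : 1 ≤ lam)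
    (hη4 : η ≤ 1 / 4) (hAη : (A + 1) * η ≤ 1)
    (hA : ∀ (C η τ : ℝ) (φ a : ℝ → ℝ), BddDerivs (K + 1) C φ → BddDerivs (K + 1) η a → η ≤ 1 →
      0 ≤ τ → τ ≤ 1 → BddDerivs (K + 1) (C * (1 + A * (τ * η))) (fun x => φ (x - τ * a x)))
    (hfB : ∀ φ, BddDerivs (K + 1) 1 φ → BddDerivs (K + 1) η (fun u => f u (φ u)))
    (hhB : ∀ φ, BddDerivs (K + 1) 1 φ → BddDerivs (K + 1) η (fun u => h u (φ u)))
    (hfL : ∀ u y z, |f u y - f u z| ≤ η * |y - z|) (hhL : ∀ u y z, |h u y - h u z| ≤ η * |y - z|)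
    (hf0 : f 0 0 = 0) (hh0 : h 0 0 = 0) {τ : ℝ} (hτ : 0 < τ) (hτ1 : τ ≤ 1) :
    ∃ φ, BddDerivs (K + 1) 1 φ ∧ φ 0 = 0 ∧ ∀ u, |graphStep f h lam τ φ u - φ u| ≤ τ ^ 2 := by
  have hden : 0 < 1 + τ * lam := by positivity
  have hball : ∀ φ, BddDerivs (K + 1) 1 φ → BddDerivs (K + 1) 1 (graphStep f h lam τ φ) := by
    intro φ hφ
    have h1 := hA 1 η τ φ _ hφ (hfB φ hφ) (by linarith) hτ.le hτ1
    have h2 := (h1.add ((hhB φ hφ).const_mul τ)).const_mul (1 + τ * lam)⁻¹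
    refine h2.of_le le_rfl ?_
    rw [abs_of_pos (inv_pos.2 hden), abs_of_pos hτ, inv_mul_le_iff₀ hden]
    -- The derivative bound becomes `(1 + A τ η + τ η) / (1 + τ lam)`, which is at most one because
    -- `(A + 1) η ≤ 1 ≤ lam`.
    have : τ * ((A + 1) * η) ≤ τ * lam := mul_le_mul_of_nonneg_left (hAη.trans hlam) hτ.le
    linarith
  have hzero : ∀ φ : ℝ → ℝ, φ 0 = 0 → graphStep f h lam τ φ 0 = 0 := by
    intro φ hφ
    simp [graphStep, hφ, hf0, hh0]
  -- The dependence of `f` and of `h` on `y` contributes `τ / 4` each; `lam ≥ 1` then gives `κ < 1`.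
  set κ : ℝ := (1 + τ * lam)⁻¹ * (1 + τ / 2) with hκ
  have hκ0 : 0 ≤ κ := by positivity
  have hκ1 : κ < 1 := by
    rw [hκ, inv_mul_lt_iff₀ hden]
    nlinarith
  have hcontr : ∀ φ ψ S, BddDerivs (K + 1) 1 φ → (∀ u, |φ u - ψ u| ≤ S) →
      ∀ u, |graphStep f h lam τ φ u - graphStep f h lam τ ψ u| ≤ κ * S := by
    intro φ ψ S hφ hS u
    rw [graphStep, graphStep, ← mul_sub, abs_mul, abs_of_pos (inv_pos.2 hden), hκ, mul_assoc]
    refine mul_le_mul_of_nonneg_left ?_ (inv_pos.2 hden).le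
    have hηS : η * |φ u - ψ u| ≤ 1 / 4 * S :=
      mul_le_mul hη4 (hS u) (abs_nonneg _) (by norm_num)
    have h1 : |φ (u - τ * f u (φ u)) - φ (u - τ * f u (ψ u))| ≤ τ * (1 / 4 * S) := by
      refine (hφ.lipschitz _ _).trans ?_
      rw [one_mul, sub_sub_sub_cancel_left, ← mul_sub, abs_mul, abs_of_pos hτ, abs_sub_comm]
      exact mul_le_mul_of_nonneg_left ((hfL _ _ _).trans hηS) hτ.le
    have h2 := hS (u - τ * f u (ψ u))
    have h3 : |τ * (h u (φ u) - h u (ψ u))| ≤ τ * (1 / 4 * S) := by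
      rw [abs_mul, abs_of_pos hτ]
      exact mul_le_mul_of_nonneg_left ((hhL _ _ _).trans hηS) hτ.le
    have e : φ (u - τ * f u (φ u)) + τ * h u (φ u) - (ψ (u - τ * f u (ψ u)) + τ * h u (ψ u)) =
        (φ (u - τ * f u (φ u)) - φ (u - τ * f u (ψ u))) +
        (φ (u - τ * f u (ψ u)) - ψ (u - τ * f u (ψ u))) + τ * (h u (φ u) - h u (ψ u)) := by ring
    rw [e]
    have := abs_add_three (φ (u - τ * f u (φ u)) - φ (u - τ * f u (ψ u)))
      (φ (u - τ * f u (ψ u)) - ψ (u - τ * f u (ψ u))) (τ * (h u (φ u) - h u (ψ u)))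
    linarith
  set it : ℕ → ℝ → ℝ := fun N => (graphStep f h lam τ)^[N] (fun _ => 0) with hit
  have hsucc : ∀ N, it (N + 1) = graphStep f h lam τ (it N) := fun N => by
    rw [hit]; exact Function.iterate_succ_apply' _ _ _
  have hb : ∀ N, BddDerivs (K + 1) 1 (it N) ∧ it N 0 = 0 := by
    intro N
    induction N with
    | zero =>
      refine ⟨⟨contDiff_const, fun i _ x => ?_⟩, rfl⟩
      simp only [hit, Function.iterate_zero, id]
      rw [iteratedDeriv_const]
      split_ifs <;> simp
    | succ N ih => rw [hsucc]; exact ⟨hball _ ih.1, hzero _ ih.2⟩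
  have hdiff : ∀ N u, |it (N + 1) u - it N u| ≤ κ ^ N := by
    intro N
    induction N with
    | zero =>
      intro u
      have : it 0 u = 0 := rfl
      rw [this, sub_zero, pow_zero]
      exact (hb 1).1.abs_le u
    | succ N ih =>
      intro u
      rw [hsucc (N + 1), hsucc N, pow_succ']
      have := hcontr (it (N + 1)) (it N) (κ ^ N) (hb _).1 ih u
      rwa [hsucc N] at this
  obtain ⟨N, hN⟩ := exists_pow_lt_of_lt_one (show 0 < τ ^ 2 by positivity) hκ1
  refine ⟨it N, (hb N).1, (hb N).2, fun u => ?_⟩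
  rw [← hsucc]
  exact (hdiff N u).trans hN.le

/-- Invariant graph theorem for `u' = f(u, y)`, `y' = -lam y + h(u, y)` with `f`, `h` small. -/
theorem exists_invariant_graph {K : ℕ} (hK : 1 ≤ K) {lam : ℝ} (hlam : 1 ≤ lam) :
    ∃ η > 0, ∀ f h : ℝ → ℝ → ℝ,
      (∀ φ, BddDerivs (K + 1) 1 φ → BddDerivs (K + 1) η (fun u => f u (φ u))) →
      (∀ φ, BddDerivs (K + 1) 1 φ → BddDerivs (K + 1) η (fun u => h u (φ u))) →
      (∀ u y z, |f u y - f u z| ≤ η * |y - z|) → (∀ u y z, |h u y - h u z| ≤ η * |y - z|) →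
      f 0 0 = 0 → h 0 0 = 0 →
      ∃ φ, BddDerivs K 1 φ ∧ φ 0 = 0 ∧
        ∀ u, f u (φ u) * deriv φ u + lam * φ u = h u (φ u) := by
  obtain ⟨A, hA0, hA⟩ := BddDerivs.exists_comp_sub_mul (K + 1)
  -- The bound `1 / 4` serves the sup-norm contraction and the maximum principle, `1 / (A + 1)` the
  -- preservation of the `C^(K+1)` ball.
  refine ⟨min (1 / 4) (1 / (A + 1)), by positivity, fun f h hfB hhB hfL hhL hf0 hh0 => ?_⟩
  set η := min (1 / 4) (1 / (A + 1)) with hηdef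
  have hη : 0 ≤ η := by positivity
  have hη4 : η ≤ 1 / 4 := min_le_left _ _
  have hAη : (A + 1) * η ≤ 1 := by
    have h1 : η ≤ 1 / (A + 1) := min_le_right _ _
    rwa [le_div_iff₀ (by positivity), mul_comm] at h1
  have hτ : ∀ n : ℕ, 0 < 1 / ((n : ℝ) + 1) ∧ 1 / ((n : ℝ) + 1) ≤ 1 := fun n =>
    ⟨by positivity, by rw [div_le_one (by positivity)]; linarith [n.cast_nonneg (α := ℝ)]⟩
  choose φ hφB hφ0 hφa using fun n : ℕ => exists_approx_fixed_graphStep hlam hη4 hAη hA hfB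
    hhB hfL hhL hf0 hh0 (hτ n).1 (hτ n).2
  set τ : ℕ → ℝ := fun n => 1 / ((n : ℝ) + 1) with hτdef
  have hφ2 : ∀ n, BddDerivs 2 1 (φ n) := fun n => (hφB n).of_le (by omega) le_rfl
  have hdφ : ∀ n u, |deriv (φ n) u| ≤ 1 := fun n u =>
    (BddDerivs.succ_iff.1 (hφB n)).2.2.abs_le u
  -- Residual of the invariance equation. Taylor expansion at `u` turns the discrete defect `τ ^ 2`
  -- into `τ E = O(τ ^ 2)`, hence `E = O(τ)`.
  set E : ℕ → ℝ → ℝ := fun n u =>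
    f u (φ n u) * deriv (φ n) u + lam * φ n u - h u (φ n u) with hE
  have hres : ∀ n u, |E n u| ≤ (lam + 2) * τ n := by
    intro n u
    have hτn := hτ n
    change 0 < τ n ∧ τ n ≤ 1 at hτn
    have hden : 0 < 1 + τ n * lam := by have := hτn.1; positivity
    set e := graphStep f h lam (τ n) (φ n) u - φ n u with he
    have h1 : |e| ≤ τ n ^ 2 := hφa n u
    have h2 := (hφ2 n).abs_taylor_le u (-(τ n * f u (φ n u)))
    have ha : |f u (φ n u)| ≤ 1 / 4 := ((hfB _ (hφB n)).abs_le u).trans hη4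
    have h3 : (1 + τ n * lam) * (φ n u + e) = φ n (u + -(τ n * f u (φ n u))) + τ n * h u (φ n u) := by
      rw [he, add_sub_cancel, graphStep, ← mul_assoc, mul_inv_cancel₀ hden.ne', one_mul,
        sub_eq_add_neg]
    set q := φ n (u + -(τ n * f u (φ n u))) - φ n u - -(τ n * f u (φ n u)) * deriv (φ n) u with hq
    have h4 : τ n * E n u = q - (1 + τ n * lam) * e := by
      simp only [hE, hq]; linarith
    have h5 : |q| ≤ τ n ^ 2 := by
      refine h2.trans ?_
      rw [one_mul, neg_sq, mul_pow]
      have : f u (φ n u) ^ 2 ≤ 1 := by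
        rw [← sq_abs]; nlinarith [abs_nonneg (f u (φ n u))]
      nlinarith [sq_nonneg (τ n)]
    have h6 : |(1 + τ n * lam) * e| ≤ (1 + lam) * τ n ^ 2 := by
      rw [abs_mul, abs_of_pos hden]
      have : 1 + τ n * lam ≤ 1 + lam := by nlinarith [hτn.2]
      exact mul_le_mul this h1 (abs_nonneg _) (by linarith)
    have h7 : |τ n * E n u| ≤ (lam + 2) * τ n ^ 2 := by
      rw [h4]; refine (abs_sub _ _).trans ?_; linarith
    rw [abs_mul, abs_of_pos hτn.1] at h7
    have : τ n * |E n u| ≤ τ n * ((lam + 2) * τ n) := by linarith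
    exact le_of_mul_le_mul_left this hτn.1
  have hle : ∀ m n u, φ m u - φ n u ≤ 2 * (lam + 2) * (τ m + τ n) := by
    intro m n u
    have hτm := (hτ m).1
    have hτn := (hτ n).1
    change 0 < τ m at hτm
    change 0 < τ n at hτn
    have hdm := (BddDerivs.succ_iff.1 (hφB m)).1
    have hdn := (BddDerivs.succ_iff.1 (hφB n)).1
    -- The difference of two approximate solutions satisfies a transport equation along `f u (φ m
    -- u)`. Replacing `φ m` by `φ n` inside `f` and `h` costs `1 / 4 + 1 / 4 = θ` times the
    -- difference, using `|deriv (φ n)| ≤ 1`.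
    have := le_of_abs_transport_le (a := fun u => f u (φ m u)) (d := fun u => φ m u - φ n u)
      (lam := lam) (S := 2) (B := η) (M := (lam + 2) * (τ m + τ n)) (θ := 1 / 2)
      (hdm.sub hdn) (fun u => by
        have h1 := (abs_le.1 ((hφB m).abs_le u)).2
        have h2 := (abs_le.1 ((hφB n).abs_le u)).1
        linarith) (fun u => (hfB _ (hφB m)).abs_le u) (by positivity) (by linarith) (fun u => by
        have ed : deriv (fun u => φ m u - φ n u) u = deriv (φ m) u - deriv (φ n) u :=
          deriv_fun_sub (hdm u) (hdn u)
        rw [ed]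
        have e : f u (φ m u) * (deriv (φ m) u - deriv (φ n) u) + lam * (φ m u - φ n u) =
            (E m u - E n u) + (h u (φ m u) - h u (φ n u)) -
              (f u (φ m u) - f u (φ n u)) * deriv (φ n) u := by
          simp only [hE]; ring
        rw [e]
        have h1 := hres m u
        have h2 := hres n u
        have h3 : |h u (φ m u) - h u (φ n u)| ≤ 1 / 4 * |φ m u - φ n u| :=
          (hhL _ _ _).trans (mul_le_mul_of_nonneg_right hη4 (abs_nonneg _))
        have h4 : |(f u (φ m u) - f u (φ n u)) * deriv (φ n) u| ≤ 1 / 4 * |φ m u - φ n u| := by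
          rw [abs_mul]
          calc _ ≤ |f u (φ m u) - f u (φ n u)| * 1 :=
                mul_le_mul_of_nonneg_left (hdφ n u) (abs_nonneg _)
            _ ≤ _ := by
                rw [mul_one]
                exact (hfL _ _ _).trans (mul_le_mul_of_nonneg_right hη4 (abs_nonneg _))
        have h5 := abs_sub ((E m u - E n u) + (h u (φ m u) - h u (φ n u)))
          ((f u (φ m u) - f u (φ n u)) * deriv (φ n) u)
        have h6 := abs_add_le (E m u - E n u) (h u (φ m u) - h u (φ n u))
        have h7 := abs_sub (E m u) (E n u)
        linarith) u
    refine this.trans ?_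
    rw [div_le_iff₀ (by linarith)]
    have : 0 < (lam + 2) * (τ m + τ n) := by positivity
    nlinarith
  have hτ0 : Tendsto τ atTop (𝓝 0) := tendsto_one_div_add_atTop_nhds_zero_nat
  have hcau : ∀ e > 0, ∃ N, ∀ m ≥ N, ∀ n ≥ N, ∀ u, |φ m u - φ n u| ≤ e := by
    intro e he
    have : ∀ᶠ n in atTop, τ n < e / (4 * (lam + 2)) := hτ0.eventually_lt_const (by positivity)
    obtain ⟨N, hN⟩ := eventually_atTop.1 this
    refine ⟨N, fun m hm n hn u => ?_⟩
    have h1 := hN m hm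
    have h2 := hN n hn
    rw [lt_div_iff₀ (by positivity)] at h1 h2
    have h3 := hle m n u
    have h4 := hle n m u
    rw [abs_le]
    constructor <;> linarith
  have hpt : ∀ u, ∃ y, Tendsto (fun m => φ m u) atTop (𝓝 y) := fun u => by
    refine cauchySeq_tendsto_of_complete (Metric.cauchySeq_iff'.2 fun e he => ?_)
    obtain ⟨N, hN⟩ := hcau (e / 2) (by positivity)
    refine ⟨N, fun m hm => ?_⟩
    rw [Real.dist_eq]
    linarith [hN m hm N le_rfl u]
  choose g hg using hpt
  have hunif : TendstoUniformly φ g atTop := by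
    refine Metric.tendstoUniformly_iff.2 fun e he => ?_
    obtain ⟨N, hN⟩ := hcau (e / 2) (by positivity)
    filter_upwards [eventually_ge_atTop N] with m hm u
    rw [Real.dist_eq]
    have : |g u - φ m u| ≤ e / 2 :=
      le_of_tendsto ((hg u).sub_const _).abs
        ((eventually_ge_atTop N).mono fun k hk => hN k hk m hm u)
    linarith
  obtain ⟨hgB, hgd⟩ := BddDerivs.of_tendstoUniformly hφB hunif
  refine ⟨g, hgB, ?_, fun u => ?_⟩
  · refine tendsto_nhds_unique (hg 0) ?_
    simp [hφ0]
  · have hcont : ∀ F : ℝ → ℝ → ℝ, (∀ u y z, |F u y - F u z| ≤ η * |y - z|) →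
        Tendsto (fun n => F u (φ n u)) atTop (𝓝 (F u (g u))) := by
      intro F hF
      have : LipschitzWith ⟨η, hη⟩ (F u) := LipschitzWith.of_dist_le_mul fun y z => hF u y z
      exact (this.continuous.tendsto _).comp (hg u)
    have h1 : Tendsto (fun n => E n u) atTop (𝓝 (f u (g u) * deriv g u + lam * g u - h u (g u))) :=
      (((hcont f hfL).mul (hgd hK u)).add ((hg u).const_mul lam)).sub (hcont h hhL)
    have h2 : Tendsto (fun n => E n u) atTop (𝓝 0) := by
      refine squeeze_zero_norm (fun n => hres n u) ?_
      simpa using hτ0.const_mul (lam + 2)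
    linarith [tendsto_nhds_unique h1 h2]

/-! ### Spectrum and center subspace of the linear part -/

section LinearPart

variable {A : (ℝ × ℝ) →ₗ[ℝ] (ℝ × ℝ)} {α β ε δ : ℝ}

theorem charpoly_of_apply_prod (hA : ∀ x y, A (x, y) = (α * y - ε * x, β * x - δ * y)) :
    A.charpoly = X ^ 2 + C (ε + δ) * X + C (ε * δ - α * β) := by
  rw [← LinearMap.charpoly_toMatrix A (Module.Basis.finTwoProd ℝ), Matrix.charpoly_fin_two]
  have h : LinearMap.toMatrix (Module.Basis.finTwoProd ℝ) (Module.Basis.finTwoProd ℝ) A =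
      !![-ε, α; β, -δ] := by
    ext i j
    fin_cases i <;> fin_cases j <;> simp [LinearMap.toMatrix_apply, hA]
  rw [h, Matrix.trace_fin_two, Matrix.det_fin_two]
  simp only [Matrix.of_apply, Matrix.cons_val', Matrix.cons_val_zero, Matrix.cons_val_one,
    Matrix.cons_val_fin_one, map_add, map_sub, map_mul, map_neg]
  ring

theorem aroots_quadratic {T D : ℝ} {z w : ℂ} (hT : z + w = -T) (hD : z * w = D) :
    (X ^ 2 + C T * X + C D : ℝ[X]).aroots ℂ = {z, w} := by
  have h : (X ^ 2 + C T * X + C D : ℝ[X]).map (algebraMap ℝ ℂ) = (X - C z) * (X - C w) := by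
    have hT' : (T : ℂ) = -(z + w) := by rw [hT, neg_neg]
    simp only [Polynomial.map_add, Polynomial.map_pow, map_X, Polynomial.map_mul, map_C,
      Complex.coe_algebraMap, hT', ← hD, C_mul, C_neg, C_add]
    ring
  rw [aroots, h, roots_mul (mul_ne_zero (X_sub_C_ne_zero _) (X_sub_C_ne_zero _)), roots_X_sub_C,
    roots_X_sub_C]
  rfl

/-- The complex roots of `X² + T X + D` with `T > 0`. -/
theorem aroots_quadratic_cases {T D : ℝ} (hT : 0 < T) :
    (∃ x y : ℝ, (X ^ 2 + C T * X + C D : ℝ[X]).aroots ℂ = {(x : ℂ), (y : ℂ)} ∧ x < 0 ∧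
      x ≤ y ∧ x * y = D) ∨
    (∃ z w : ℂ, (X ^ 2 + C T * X + C D : ℝ[X]).aroots ℂ = {z, w} ∧ z.re < 0 ∧ w.re < 0 ∧
      z.im ≠ 0 ∧ w.im ≠ 0 ∧ 0 < D) := by
  rcases le_or_gt 0 (T ^ 2 - 4 * D) with h | h
  · left
    have hs := Real.sq_sqrt h
    have hs0 := Real.sqrt_nonneg (T ^ 2 - 4 * D)
    set s := √(T ^ 2 - 4 * D)
    refine ⟨(-T - s) / 2, (-T + s) / 2, aroots_quadratic ?_ ?_, by linarith, by linarith,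
      by nlinarith⟩
    · push_cast; ring
    · have : (-T - s) / 2 * ((-T + s) / 2) = D := by nlinarith
      exact_mod_cast this
  · right
    have hs := Real.sq_sqrt (show 0 ≤ 4 * D - T ^ 2 by linarith)
    have hs0 := Real.sqrt_pos.2 (show 0 < 4 * D - T ^ 2 by linarith)
    set s := √(4 * D - T ^ 2)
    refine ⟨⟨-T / 2, s / 2⟩, ⟨-T / 2, -s / 2⟩, aroots_quadratic ?_ ?_,
      by linarith [show (⟨-T / 2, s / 2⟩ : ℂ).re = -T / 2 from rfl],
      by linarith [show (⟨-T / 2, -s / 2⟩ : ℂ).re = -T / 2 from rfl],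
      by simpa using hs0.ne', by simpa using hs0.ne', by nlinarith⟩
    · apply Complex.ext
      · simp
      · simp; ring
    · apply Complex.ext
      · simp; nlinarith
      · simp; ring

/-- With negative trace and nonzero determinant no eigenvalue is purely imaginary. An admissible `q`
is therefore coprime to the characteristic polynomial, and Bézout with Cayley–Hamilton makes `q(A)`
injective. -/
theorem centerSubspace_eq_bot (hA : ∀ x y, A (x, y) = (α * y - ε * x, β * x - δ * y))
    (hT : 0 < ε + δ) (hD : α * β ≠ ε * δ) : centerSubspace A = ⊥ := by
  rw [centerSubspace, iSup₂_eq_bot]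
  rintro q ⟨hq0, hq⟩
  have hcop : IsCoprime A.charpoly q := by
    rw [isCoprime_iff_aeval_ne_zero_of_isAlgClosed ℝ ℂ]
    intro z
    by_contra! hz
    have hzq : z.re = 0 := hq z ((mem_aroots).2 ⟨hq0, hz.2⟩)
    have hzA : z ∈ A.charpoly.aroots ℂ := (mem_aroots).2 ⟨(LinearMap.charpoly_monic A).ne_zero, hz.1⟩
    rw [charpoly_of_apply_prod hA] at hzA
    rcases aroots_quadratic_cases (D := ε * δ - α * β) hT with
      ⟨x, y, h, hx, -, hxy⟩ | ⟨z', w', h, h1, h2, -⟩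
    · rw [h] at hzA
      simp only [Multiset.insert_eq_cons, Multiset.mem_cons, Multiset.mem_singleton] at hzA
      rcases hzA with rfl | rfl
      · exact hx.ne hzq
      · have : y = 0 := hzq
        rw [this, mul_zero] at hxy
        exact hD (by linarith)
    · rw [h] at hzA
      simp only [Multiset.insert_eq_cons, Multiset.mem_cons, Multiset.mem_singleton] at hzA
      rcases hzA with rfl | rfl
      · exact h1.ne hzq
      · exact h2.ne hzq
  obtain ⟨a, b, hab⟩ := hcop
  refine (Submodule.eq_bot_iff _).2 fun w hw => ?_
  have := congrArg (fun r => aeval A r w) hab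
  simpa [LinearMap.aeval_self_charpoly, LinearMap.mem_ker.1 hw] using this.symm

/-- In the eigenbasis `(α, ε)`, `(α, -δ)` with eigenvalues `0` and `-(ε + δ)`, an admissible `q`
does not vanish at `-(ε + δ)`, so the kernel of `q(A)` has no second component. Conversely `q = X`
already yields the first eigenvector. -/
theorem centerSubspace_eq_span (hA : ∀ x y, A (x, y) = (α * y - ε * x, β * x - δ * y))
    (hε : 0 < ε) (hδ : 0 < δ) (hD : α * β = ε * δ) :
    centerSubspace A = Submodule.span ℝ {(α, ε)} := by
  have hα : α ≠ 0 := by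
    rintro rfl
    rw [zero_mul] at hD
    exact (mul_pos hε hδ).ne hD
  have hv : Module.End.HasEigenvector A 0 ((α, ε) : ℝ × ℝ) := by
    refine ⟨Module.End.mem_eigenspace_iff.2 ?_, fun h => hα (congrArg Prod.fst h)⟩
    rw [hA, zero_smul]
    ext <;> simp <;> linarith
  have he : Module.End.HasEigenvector A (-(ε + δ)) ((α, -δ) : ℝ × ℝ) := by
    refine ⟨Module.End.mem_eigenspace_iff.2 ?_, fun h => hα (congrArg Prod.fst h)⟩
    rw [hA]
    ext <;> simp <;> linarith
  apply le_antisymm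
  · refine iSup₂_le ?_
    rintro q ⟨hq0, hq⟩ ⟨x, y⟩ hw
    set c := (δ * x + α * y) / (α * (ε + δ)) with hc
    set d := (ε * x - α * y) / (α * (ε + δ)) with hd
    have hsum : ((x, y) : ℝ × ℝ) = c • (α, ε) + d • (α, -δ) := by
      have : ε + δ ≠ 0 := by positivity
      ext <;> simp [hc, hd] <;> field_simp <;> ring
    rw [LinearMap.mem_ker, hsum, map_add, map_smul, map_smul,
      Module.End.aeval_apply_of_hasEigenvector hv, Module.End.aeval_apply_of_hasEigenvector he] at hw
    have hqe : q.eval (-(ε + δ)) ≠ 0 := by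
      intro h0
      have := hq ((-(ε + δ) : ℝ) : ℂ) ((mem_aroots).2 ⟨hq0, by
        rw [← Complex.coe_algebraMap, aeval_algebraMap_apply, coe_aeval_eq_eval, h0, map_zero]⟩)
      rw [Complex.ofReal_re] at this
      linarith
    have h1 := congrArg Prod.fst hw
    have h2 := congrArg Prod.snd hw
    simp only [Prod.fst_add, Prod.snd_add, Prod.smul_fst, Prod.smul_snd, smul_eq_mul,
      Prod.fst_zero, Prod.snd_zero] at h1 h2
    have hd0 : d = 0 := by
      have h3 : d * eval (-(ε + δ)) q * (α * (ε + δ)) = 0 := by linear_combination ε * h1 - α * h2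
      have h4 : α * (ε + δ) ≠ 0 := mul_ne_zero hα (by positivity)
      have h5 := (mul_eq_zero.1 h3).resolve_right h4
      exact (mul_eq_zero.1 h5).resolve_right hqe
    rw [hsum, hd0, zero_smul, add_zero]
    exact Submodule.smul_mem _ _ (Submodule.mem_span_singleton_self _)
  · rw [Submodule.span_singleton_le_iff_mem]
    have hX : (X : ℝ[X]) ∈ {q : ℝ[X] | q ≠ 0 ∧ ∀ z ∈ q.aroots ℂ, z.re = 0} := by
      refine ⟨X_ne_zero, fun z hz => ?_⟩
      rw [aroots_X, Multiset.mem_singleton] at hz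
      simp [hz]
    refine (le_iSup₂ (f := fun q (_ : q ∈ {q : ℝ[X] | q ≠ 0 ∧ ∀ z ∈ q.aroots ℂ, z.re = 0}) =>
      LinearMap.ker (aeval A q)) X hX) ?_
    rw [LinearMap.mem_ker, Module.End.aeval_apply_of_hasEigenvector hv]
    simp

end LinearPart

/-! ### The platform field and the types of its fixed points -/

section PlatformField

variable {V W : ℝ → ℝ} {ε δ : ℝ}

theorem contDiff_platformField (hV : ContDiff ℝ ∞ V) (hW : ContDiff ℝ ∞ W) :
    ContDiff ℝ ∞ (platformField V W ε δ) := by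
  unfold platformField
  exact ((hV.comp contDiff_snd).sub (contDiff_const.mul contDiff_fst)).prodMk
    ((hW.comp contDiff_fst).sub (contDiff_const.mul contDiff_snd))

theorem linearization_platformField (hV : ContDiff ℝ ∞ V) (hW : ContDiff ℝ ∞ W) (b g x y : ℝ) :
    linearization (platformField V W ε δ) (b, g) (x, y) =
      (deriv V g * y - ε * x, deriv W b * x - δ * y) := by
  have hVd : HasDerivAt V (deriv V g) ((b, g) : ℝ × ℝ).2 := (hV.differentiable (by simp) g).hasDerivAt
  have hWd : HasDerivAt W (deriv W b) ((b, g) : ℝ × ℝ).1 := (hW.differentiable (by simp) b).hasDerivAt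
  have h1 := (hVd.comp_hasFDerivAt (b, g) hasFDerivAt_snd).sub
    ((hasFDerivAt_fst (𝕜 := ℝ) (p := ((b, g) : ℝ × ℝ))).const_mul ε)
  have h2 := (hWd.comp_hasFDerivAt (b, g) hasFDerivAt_fst).sub
    ((hasFDerivAt_snd (𝕜 := ℝ) (p := ((b, g) : ℝ × ℝ))).const_mul δ)
  have h := h1.prodMk h2
  have e : fderiv ℝ (platformField V W ε δ) (b, g) = _ := h.fderiv
  rw [linearization, e]
  simp

theorem platformFixedPoints_eq : platformFixedPoints V W ε δ =
    {p : ℝ × ℝ | p ∈ unitSquare ∧ ε * p.1 = V p.2 ∧ δ * p.2 = W p.1} := by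
  ext p
  have : IsIntegralCurve (fun _ => p) (fun _ => platformField V W ε δ) ↔
      platformField V W ε δ p = 0 := by
    constructor
    · intro h
      exact (h 0).unique (hasDerivAt_const _ _)
    · intro h t
      simp only [h]
      exact hasDerivAt_const _ _
  simp only [platformFixedPoints, mem_ofPred_eq, this, platformField, Prod.mk_eq_zero, sub_eq_zero]
  grind

theorem eigenvaluesAt_platformField (hV : ContDiff ℝ ∞ V) (hW : ContDiff ℝ ∞ W) (b g : ℝ) :
    eigenvaluesAt (platformField V W ε δ) (b, g) =
      (X ^ 2 + C (ε + δ) * X + C (ε * δ - deriv V g * deriv W b) : ℝ[X]).aroots ℂ := by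
  rw [eigenvaluesAt, charpoly_of_apply_prod (linearization_platformField hV hW b g)]

/-- If the eigenvalues are real, the smaller one `x` is negative and the product is `εδ - V' W'`, so
the sign of the larger one is that of `V' W' - εδ`. Non-real eigenvalues have real part `-(ε + δ) /
2` and force `V' W' < εδ`. -/
theorem platformField_classification (hε : 1 ≤ ε) (hδ : 1 ≤ δ) (hV : ContDiff ℝ ∞ V)
    (hW : ContDiff ℝ ∞ W) (b g : ℝ) :
    (IsStableNode (platformField V W ε δ) (b, g) ∨ IsStableSpiral (platformField V W ε δ) (b, g) ∨
      IsSaddle (platformField V W ε δ) (b, g) ∨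
      IsSaddleNodeType (platformField V W ε δ) (b, g)) ∧
    ¬ IsRepelling (platformField V W ε δ) (b, g) ∧
    (∃ μ ∈ eigenvaluesAt (platformField V W ε δ) (b, g), μ.re < 0) ∧
    ((IsStableNode (platformField V W ε δ) (b, g) ∨
        IsStableSpiral (platformField V W ε δ) (b, g)) ↔ deriv V g * deriv W b < ε * δ) ∧
    (IsSaddle (platformField V W ε δ) (b, g) ↔ deriv V g * deriv W b > ε * δ) := by
  have hT : 0 < ε + δ := by linarith
  simp only [IsStableNode, IsStableSpiral, IsSaddle, IsSaddleNodeType, IsRepelling,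
    eigenvaluesAt_platformField hV hW]
  set D := ε * δ - deriv V g * deriv W b with hD
  rcases aroots_quadratic_cases (D := D) hT with ⟨x, y, h, hx, hxy, hxD⟩ |
    ⟨z, w, h, hz, hw, hzi, hwi, hD0⟩
  · rw [h]
    have hsad : (∃ μ₁ μ₂ : ℝ, μ₁ < 0 ∧ 0 < μ₂ ∧ ({(x : ℂ), (y : ℂ)} : Multiset ℂ) =
        {(μ₁ : ℂ), (μ₂ : ℂ)}) ↔ 0 < y := by
      constructor
      · rintro ⟨μ₁, μ₂, h1, h2, h3⟩
        have : (μ₂ : ℂ) ∈ ({(x : ℂ), (y : ℂ)} : Multiset ℂ) := by rw [h3]; simp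
        simp only [Multiset.insert_eq_cons, Multiset.mem_cons, Multiset.mem_singleton,
          Complex.ofReal_inj] at this
        rcases this with rfl | rfl
        · linarith
        · exact h2
      · intro hy
        exact ⟨x, y, hx, hy, rfl⟩
    have hnode : (∀ μ ∈ ({(x : ℂ), (y : ℂ)} : Multiset ℂ), μ.im = 0 ∧ μ.re < 0) ↔ y < 0 := by
      simp [hx]
    have hspir : ¬ ∀ μ ∈ ({(x : ℂ), (y : ℂ)} : Multiset ℂ), μ.im ≠ 0 ∧ μ.re < 0 := by
      simp
    have hy1 : 0 < y ↔ deriv V g * deriv W b > ε * δ := by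
      constructor <;> intro hh <;> nlinarith
    have hy2 : y < 0 ↔ deriv V g * deriv W b < ε * δ := by
      constructor <;> intro hh <;> nlinarith
    rw [hsad, hnode]
    refine ⟨?_, by simp [hx.le], ⟨x, by simp, by simpa using hx⟩, by simp only [hspir, or_false, hy2],
      hy1⟩
    rcases lt_trichotomy y 0 with hy | hy | hy
    · exact Or.inl hy
    · exact Or.inr (Or.inr (Or.inr ⟨x, hx, by simp [hy]⟩))
    · exact Or.inr (Or.inr (Or.inl hy))
  · rw [h]
    have hspir : ∀ μ ∈ ({z, w} : Multiset ℂ), μ.im ≠ 0 ∧ μ.re < 0 := by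
      simp [hz, hw, hzi, hwi]
    have hsad : ¬ ∃ μ₁ μ₂ : ℝ, μ₁ < 0 ∧ 0 < μ₂ ∧ ({z, w} : Multiset ℂ) =
        {(μ₁ : ℂ), (μ₂ : ℂ)} := by
      rintro ⟨μ₁, μ₂, -, -, h3⟩
      have := hspir μ₁ (by rw [h3]; simp)
      simp at this
    refine ⟨Or.inr (Or.inl hspir), by simp [hz.le], ⟨z, by simp, hz⟩, ?_, ?_⟩
    · exact iff_of_true (Or.inr hspir) (by linarith)
    · exact iff_of_false hsad (by linarith)

end PlatformField

/-! ### Scalar equations and motion along a branch -/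

/-- An autonomous scalar equation with continuous, positive, bounded right-hand side has a solution
that is an increasing bijection of the line. -/
theorem exists_strictMono_solution {h : ℝ → ℝ} {C : ℝ} (hc : Continuous h) (h0 : ∀ u, 0 < h u)
    (hC : ∀ u, h u ≤ C) :
    ∃ σ : ℝ → ℝ, StrictMono σ ∧ Function.Surjective σ ∧ ∀ t, HasDerivAt σ (h (σ t)) t := by
  have hCpos : 0 < C := (h0 0).trans_le (hC 0)
  have hci : Continuous fun u => (h u)⁻¹ := hc.inv₀ fun u => (h0 u).ne'
  -- The travel time from `0` to `u`. As `h ≤ C`, it grows at least like `u / C` in both directions,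
  -- so it is a bijection whose inverse is the solution.
  set T : ℝ → ℝ := fun u => ∫ x in (0 : ℝ)..u, (h x)⁻¹ with hT
  have hTd : ∀ u, HasDerivAt T (h u)⁻¹ u := fun u => hci.integral_hasStrictDerivAt 0 u |>.hasDerivAt
  have hTc : Continuous T := continuous_iff_continuousAt.2 fun u => (hTd u).continuousAt
  have hmono : StrictMono T := strictMono_of_deriv_pos fun u => by
    rw [(hTd u).deriv]; exact inv_pos.2 (h0 u)
  have hgrow : Monotone fun u => T u - C⁻¹ * u := by
    have hd : ∀ u, HasDerivAt (fun u => T u - C⁻¹ * u) ((h u)⁻¹ - C⁻¹) u := fun u => by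
      simpa using (hTd u).fun_sub ((hasDerivAt_id u).const_mul C⁻¹)
    refine monotone_of_deriv_nonneg (fun u => (hd u).differentiableAt) fun u => ?_
    rw [(hd u).deriv, sub_nonneg]
    exact inv_anti₀ (h0 u) (hC u)
  have hT0 : T 0 = 0 := by simp [hT]
  have htop : Tendsto T atTop atTop := by
    refine tendsto_atTop_mono' _ ?_ (tendsto_id.const_mul_atTop (inv_pos.2 hCpos))
    filter_upwards [eventually_ge_atTop 0] with u hu
    have := hgrow hu
    simp only [hT0, mul_zero, sub_zero] at this
    simpa using this
  have hbot : Tendsto T atBot atBot := by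
    refine tendsto_atBot_mono' _ ?_ (tendsto_id.const_mul_atBot (inv_pos.2 hCpos))
    filter_upwards [eventually_le_atBot 0] with u hu
    have := hgrow hu
    simp only [hT0, mul_zero, sub_zero] at this
    simpa using this
  have hsurj := hTc.surjective htop hbot
  set e := hmono.orderIsoOfSurjective T hsurj with he
  have heT : ∀ u, e u = T u := fun u => rfl
  refine ⟨e.symm, e.symm.strictMono, e.symm.surjective, fun t => ?_⟩
  have := HasDerivAt.of_local_left_inverse (f := T) (g := e.symm) (a := t)
    (e.symm.toHomeomorph.continuous.continuousAt) (hTd (e.symm t)) (inv_pos.2 (h0 _)).ne'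
    (Eventually.of_forall fun y => by rw [← heT]; exact e.apply_symm_apply y)
  rwa [inv_inv] at this

/-- Solution of `s' = e(s)` emanating from `0`, where `0 < e(s) ≤ C s` on `(0, ρ]`. -/
theorem exists_solution_from_zero {e : ℝ → ℝ} {C ρ : ℝ} (hρ : 0 < ρ)
    (hc : ContinuousOn e (Ioc 0 ρ)) (h0 : ∀ s ∈ Ioc 0 ρ, 0 < e s) (hC : ∀ s ∈ Ioc 0 ρ, e s ≤ C * s) :
    ∃ S : ℝ → ℝ, StrictMono S ∧ (∀ t, 0 < S t) ∧ (∀ s, 0 < s → ∃ t, S t = s) ∧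
      (∀ t, S t ≤ ρ → HasDerivAt S (e (S t)) t) ∧ Tendsto S atBot (𝓝 0) := by
  -- With `s = exp u` the equation becomes `u' = e(exp u) / exp u`, bounded by `C`, so `s = 0` is
  -- reached only as `t → -∞`. Freezing the argument at `ρ` makes the right-hand side global; the
  -- equation is claimed only while `S t ≤ ρ`.
  set m : ℝ → ℝ := fun u => min (Real.exp u) ρ with hm
  have hmem : ∀ u, m u ∈ Ioc 0 ρ := fun u => ⟨lt_min (Real.exp_pos u) hρ, min_le_right _ _⟩
  have hmc : Continuous m := Real.continuous_exp.min continuous_const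
  obtain ⟨σ, hσm, hσs, hσd⟩ := exists_strictMono_solution (h := fun u => e (m u) / m u) (C := C)
    ((hc.comp_continuous hmc hmem).div hmc fun u => (hmem u).1.ne')
    (fun u => div_pos (h0 _ (hmem u)) (hmem u).1)
    (fun u => (div_le_iff₀ (hmem u).1).2 (hC _ (hmem u)))
  refine ⟨fun t => Real.exp (σ t), Real.exp_strictMono.comp hσm, fun t => Real.exp_pos _,
    fun s hs => ?_, fun t ht => ?_, ?_⟩
  · obtain ⟨t, ht⟩ := hσs (Real.log s)
    exact ⟨t, by simp only [ht, Real.exp_log hs]⟩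
  · have h1 : m (σ t) = Real.exp (σ t) := min_eq_left ht
    have := (hσd t).exp
    rwa [h1, mul_div_cancel₀ _ (Real.exp_pos _).ne'] at this
  · exact Real.tendsto_exp_atBot.comp (hσm.monotone.tendsto_atBot_atBot fun b => by
      obtain ⟨t, ht⟩ := hσs b; exact ⟨t, ht.le⟩)

/-- Forward uniqueness on a compact time interval for a `C¹` vector field. -/
theorem eqOn_of_hasDerivWithinAt {F : ℝ × ℝ → ℝ × ℝ} (hF : ContDiff ℝ 1 F) {x y : ℝ → ℝ × ℝ} {T : ℝ}
    (hx : ∀ t ∈ Icc 0 T, HasDerivWithinAt x (F (x t)) (Ici t) t) (hxc : ContinuousOn x (Icc 0 T))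
    (hy : ∀ t ∈ Icc 0 T, HasDerivWithinAt y (F (y t)) (Ici t) t) (hyc : ContinuousOn y (Icc 0 T))
    (h0 : x 0 = y 0) : EqOn x y (Icc 0 T) := by
  obtain ⟨R, hR⟩ := ((isCompact_Icc.image_of_continuousOn hxc).union
    (isCompact_Icc.image_of_continuousOn hyc)).isBounded.subset_closedBall 0
  obtain ⟨K, hK⟩ := hF.contDiffOn.exists_lipschitzOnWith (s := Metric.closedBall 0 R) one_ne_zero
    (convex_closedBall 0 R) (isCompact_closedBall 0 R)
  exact ODE_solution_unique_of_mem_Icc_right (v := fun _ => F) (s := fun _ => Metric.closedBall 0 R)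
    (K := K) (fun _ _ => hK) hxc (fun t ht => hx t (Ico_subset_Icc_self ht))
    (fun t ht => hR (Or.inl (mem_image_of_mem _ (Ico_subset_Icc_self ht)))) hyc
    (fun t ht => hy t (Ico_subset_Icc_self ht))
    (fun t ht => hR (Or.inr (mem_image_of_mem _ (Ico_subset_Icc_self ht)))) h0

/-- A curve `β` on `(0, r)` ending at `p`, along which the field `F` is `a` times the velocity `β'`
with `a(s) = O(s)`. -/
structure IsInvariantBranch (F : ℝ × ℝ → ℝ × ℝ) (p : ℝ × ℝ) (β β' : ℝ → ℝ × ℝ) (r : ℝ) (a : ℝ → ℝ)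
    (C ρ : ℝ) : Prop where
  pos : 0 < ρ
  le : ρ ≤ r
  hasDerivAt : ∀ s ∈ Ioo 0 r, HasDerivAt β (β' s) s
  field_eq : ∀ s ∈ Ioo 0 r, F (β s) = a s • β' s
  continuousOn : ContinuousOn a (Ioo 0 r)
  bound : ∀ s ∈ Ioo 0 ρ, |a s| ≤ C * s
  tendsto : Tendsto β (𝓝[>] 0) (𝓝 p)

namespace IsInvariantBranch

variable {F : ℝ × ℝ → ℝ × ℝ} {p : ℝ × ℝ} {β β' : ℝ → ℝ × ℝ} {r : ℝ} {a : ℝ → ℝ} {C ρ : ℝ}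

theorem mono (h : IsInvariantBranch F p β β' r a C ρ) {ρ' : ℝ} (h0 : 0 < ρ') (h1 : ρ' ≤ ρ) :
    IsInvariantBranch F p β β' r a C ρ' :=
  { h with pos := h0, le := h1.trans h.le, bound := fun s hs => h.bound s ⟨hs.1, hs.2.trans_le h1⟩ }

theorem branchConverges (h : IsInvariantBranch F p β β' r a C ρ) (ha : ∀ s ∈ Ioo 0 ρ, a s < 0) :
    BranchConverges F p β r := by
  have hρ := h.pos
  have hsub : Ioc 0 (ρ / 2) ⊆ Ioo 0 ρ := fun s hs => ⟨hs.1, by linarith [hs.2]⟩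
  have hsub' : Ioo 0 ρ ⊆ Ioo 0 r := Ioo_subset_Ioo_right h.le
  obtain ⟨S, hSm, hSp, hSs, hSd, hSt⟩ := exists_solution_from_zero (e := fun s => -a s) (C := C)
    (half_pos hρ) ((h.continuousOn.mono (hsub.trans hsub')).neg)
    (fun s hs => neg_pos.2 (ha s (hsub hs)))
    (fun s hs => (neg_le_abs _).trans (h.bound s (hsub hs)))
  refine ⟨ρ / 2, ⟨half_pos hρ, by linarith [h.le]⟩, fun s hs => ?_⟩
  obtain ⟨t₀, rfl⟩ := hSs s hs.1
  have hle : ∀ t ∈ Ici (0 : ℝ), S (t₀ - t) ≤ ρ / 2 := fun t ht =>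
    (hSm.monotone (sub_le_self t₀ ht)).trans hs.2.le
  have hmem : ∀ t ∈ Ici (0 : ℝ), S (t₀ - t) ∈ Ioo 0 r := fun t ht =>
    hsub' (hsub ⟨hSp _, hle t ht⟩)
  -- `S` solves the reversed equation `s' = -a(s)`, so time runs backwards along it.
  refine ⟨fun t => β (S (t₀ - t)), fun t ht => ?_, by simp, fun t ht => ⟨_, hmem t ht, rfl⟩, ?_⟩
  · have h1 : HasDerivAt (fun t => S (t₀ - t)) (-(-a (S (t₀ - t)))) t :=
      (hSd _ (hle t ht)).comp_const_sub t₀ t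
    have h2 := (h.hasDerivAt _ (hmem t ht)).scomp t h1
    rw [neg_neg, ← h.field_eq _ (hmem t ht)] at h2
    exact h2.hasDerivWithinAt
  · have h1 : Tendsto (fun t => t₀ - t) atTop atBot :=
      tendsto_const_nhds.add_atBot tendsto_neg_atTop_atBot |>.congr fun t => (sub_eq_add_neg _ _).symm
    exact h.tendsto.comp (tendsto_nhdsWithin_iff.2 ⟨hSt.comp h1, Eventually.of_forall fun t => hSp _⟩)

theorem branchDiverges (h : IsInvariantBranch F p β β' r a C ρ) (ha : ∀ s ∈ Ioo 0 ρ, 0 < a s)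
    (hF : ContDiff ℝ 1 F) (hne : ∀ s ∈ Ioo 0 r, β s ≠ p) :
    BranchDiverges F p β r := by
  have hρ := h.pos
  have hsub : Ioc 0 (ρ / 2) ⊆ Ioo 0 ρ := fun s hs => ⟨hs.1, by linarith [hs.2]⟩
  have hsub' : Ioo 0 ρ ⊆ Ioo 0 r := Ioo_subset_Ioo_right h.le
  obtain ⟨S, hSm, hSp, hSs, hSd, hSt⟩ := exists_solution_from_zero (e := a) (C := C)
    (half_pos hρ) (h.continuousOn.mono (hsub.trans hsub'))
    (fun s hs => ha s (hsub hs))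
    (fun s hs => (le_abs_self _).trans (h.bound s (hsub hs)))
  have hmem : ∀ t, S t ≤ ρ / 2 → S t ∈ Ioo 0 r := fun t ht => hsub' (hsub ⟨hSp _, ht⟩)
  have hder : ∀ t₀ t, S (t + t₀) ≤ ρ / 2 →
      HasDerivAt (fun t => β (S (t + t₀))) (F (β (S (t + t₀)))) t := by
    intro t₀ t ht
    have h1 : HasDerivAt (fun t => S (t + t₀)) (a (S (t + t₀))) t :=
      (hSd _ ht).comp_add_const t t₀
    have h2 := (h.hasDerivAt _ (hmem _ ht)).scomp t h1
    rwa [← h.field_eq _ (hmem _ ht)] at h2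
  -- The excluded neighbourhood only omits the point `β (ρ / 2)`, which differs from `p`: by
  -- uniqueness every forward trajectory follows `β ∘ S` until it hits this point.
  refine ⟨ρ / 2, ⟨half_pos hρ, by linarith [h.le]⟩, fun s hs => ?_, {β (ρ / 2)}ᶜ, ?_,
    fun s hs x hx hx0 => ?_⟩
  · obtain ⟨t₀, rfl⟩ := hSs s hs.1
    have hle : ∀ t ∈ Iic (0 : ℝ), S (t + t₀) ≤ ρ / 2 := fun t ht =>
      (hSm.monotone (add_le_of_nonpos_left ht)).trans hs.2.le
    refine ⟨fun t => β (S (t + t₀)), fun t ht => (hder t₀ t (hle t ht)).hasDerivWithinAt, by simp,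
      fun t ht => ⟨_, hmem _ (hle t ht), rfl⟩, ?_⟩
    exact h.tendsto.comp (tendsto_nhdsWithin_iff.2
      ⟨hSt.comp (tendsto_atBot_add_const_right _ t₀ tendsto_id), Eventually.of_forall fun t => hSp _⟩)
  · exact isOpen_compl_singleton.mem_nhds
      (hne _ (hsub' (hsub ⟨half_pos hρ, le_rfl⟩))).symm
  · obtain ⟨t₀, rfl⟩ := hSs s hs.1
    obtain ⟨t₁, ht₁⟩ := hSs (ρ / 2) (half_pos hρ)
    have hlt : t₀ < t₁ := hSm.lt_iff_lt.1 (by rw [ht₁]; exact hs.2)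
    have hle : ∀ t ∈ Icc 0 (t₁ - t₀), S (t + t₀) ≤ ρ / 2 := fun t ht => by
      rw [← ht₁]; exact hSm.monotone (by linarith [ht.2])
    have hx' : ∀ t ∈ Icc 0 (t₁ - t₀), HasDerivWithinAt x (F (x t)) (Ici t) t := fun t ht =>
      (hx t ht.1).mono (Ici_subset_Ici.2 ht.1)
    have heq := eqOn_of_hasDerivWithinAt hF hx' (hx.continuousOn.mono fun t ht => ht.1)
      (fun t ht => (hder t₀ t (hle t ht)).hasDerivWithinAt)
      (fun t ht => (hder t₀ t (hle t ht)).continuousAt.continuousWithinAt) (by simpa using hx0)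
    refine ⟨t₁ - t₀, sub_nonneg.2 hlt.le, ?_⟩
    have := heq (right_mem_Icc.2 (sub_nonneg.2 hlt.le))
    simp only [sub_add_cancel, ht₁] at this
    simpa using this

theorem converges_or_diverges (h : IsInvariantBranch F p β β' r a C ρ)
    (ha : ∀ s ∈ Ioo 0 ρ, a s ≠ 0) (hF : ContDiff ℝ 1 F) (hne : ∀ s ∈ Ioo 0 r, β s ≠ p) :
    BranchConverges F p β r ∨ BranchDiverges F p β r := by
  by_cases hneg : ∀ s ∈ Ioo 0 ρ, a s < 0
  · exact Or.inl (h.branchConverges hneg)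
  · push Not at hneg
    obtain ⟨s₀, hs₀, has₀⟩ := hneg
    refine Or.inr (h.branchDiverges (fun s hs => ?_) hF hne)
    by_contra! hle
    obtain ⟨z, hz, hz0⟩ := isPreconnected_Ioo.intermediate_value hs hs₀
      (h.continuousOn.mono (Ioo_subset_Ioo_right h.le)) ⟨hle, has₀⟩
    exact ha z hz hz0

end IsInvariantBranch

/-! ### Center manifolds as invariant branches -/

namespace IsCenterManifold

variable {F : ℝ × ℝ → ℝ × ℝ} {p : ℝ × ℝ} {γ : ℝ → ℝ × ℝ} {r : ℝ}

theorem hasDerivAt (h : IsCenterManifold F p 1 γ r) {s : ℝ} (hs : s ∈ Ioo (-r) r) :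
    HasDerivAt γ (deriv γ s) s :=
  ((h.contDiffOn.differentiableOn (by simp)).differentiableAt
    (Ioo_mem_nhds hs.1 hs.2)).hasDerivAt

theorem continuousOn_deriv (h : IsCenterManifold F p 1 γ r) :
    ContinuousOn (deriv γ) (Ioo (-r) r) :=
  h.contDiffOn.continuousOn_deriv_of_isOpen isOpen_Ioo (by simp)

theorem injOn (h : IsCenterManifold F p 1 γ r) : InjOn γ (Ioo (-r) r) :=
  injOn_iff_injective.2 h.isEmbedding.injective

theorem zero_mem (h : IsCenterManifold F p 1 γ r) : (0 : ℝ) ∈ Ioo (-r) r :=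
  ⟨neg_lt_zero.2 h.pos, h.pos⟩

/-- A solution confined to the arc moves tangentially. For a covector `n` killing `γ'(s)`, the
variation of `n` along the arc is `o` of the displacement, so `n(x(t))` has zero derivative and
`n(F) = 0`. Only continuity of the parameter `σ(t)` is needed, which the embedding provides. -/
theorem exists_smul_deriv (h : IsCenterManifold F p 1 γ r) (hF : ContDiff ℝ 1 F) {s : ℝ}
    (hs : s ∈ Ioo (-r) r) : ∃ c : ℝ, F (γ s) = c • deriv γ s := by
  obtain ⟨x, hx0, e, he, hx⟩ :=
    (hF.contDiffAt (x := γ s)).exists_forall_mem_closedBall_exists_eq_forall_mem_Ioo_hasDerivAt₀ 0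
  have hxI : IsIntegralCurveAt x (fun _ => F) 0 := by
    filter_upwards [Ioo_mem_nhds (by linarith : 0 - e < 0) (by linarith : 0 < 0 + e)] with t ht
    exact hx t ht
  have hxd : HasDerivAt x (F (γ s)) 0 := by
    have := hxI.hasDerivAt
    rwa [hx0] at this
  have hstay := h.invariant s hs x hxI hx0
  -- Times at which the solution is off the arc get the default parameter `s`; they do not occur
  -- near `0`.
  have : ∀ t, ∃ σ : Ioo (-r) r, x t ∈ γ '' Ioo (-r) r → γ σ = x t := fun t => by
    by_cases ht : x t ∈ γ '' Ioo (-r) r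
    · obtain ⟨σ, hσ, e⟩ := ht
      exact ⟨⟨σ, hσ⟩, fun _ => e⟩
    · exact ⟨⟨s, hs⟩, fun h' => absurd h' ht⟩
  choose σ hσ using this
  have hσ' : ∀ᶠ t in 𝓝 0, γ (σ t) = x t := hstay.mono fun t ht => hσ t ht
  have hlim : Tendsto (fun t => (σ t : ℝ)) (𝓝 0) (𝓝 s) := by
    have h1 : Tendsto σ (𝓝 0) (𝓝 ⟨s, hs⟩) := by
      rw [h.isEmbedding.isInducing.tendsto_nhds_iff]
      have h2 : Tendsto x (𝓝 0) (𝓝 (γ s)) := hx0 ▸ hxd.continuousAt.tendsto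
      exact h2.congr' (hσ'.mono fun t ht => ht.symm)
    exact (continuous_subtype_val.tendsto _).comp h1
  set v := deriv γ s with hv
  have hv0 : v ≠ 0 := h.deriv_ne_zero s hs
  set n : ℝ × ℝ →L[ℝ] ℝ := v.2 • ContinuousLinearMap.fst ℝ ℝ ℝ - v.1 • ContinuousLinearMap.snd ℝ ℝ ℝ
    with hn
  have hnv : n v = 0 := by simp [hn]; ring
  have hγd := h.hasDerivAt hs
  have h1 : (fun y => n (γ y) - n (γ s)) =o[𝓝 s] fun y => y - s := by
    have := (n.hasFDerivAt.comp_hasDerivAt s hγd).isLittleO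
    simpa only [Function.comp_def, ← hv, hnv, smul_zero, sub_zero] using this
  -- A nonzero velocity bounds the parameter increment by the displacement.
  have h2 : (fun y => y - s) =O[𝓝 s] fun y => γ y - γ s :=
    (HasDerivAtFilter.isTheta_sub hγd hv0).isBigO_symm.comp_tendsto
      (tendsto_id.prodMk (tendsto_pure.2 (Eventually.of_forall fun _ => rfl)))
  have h3 : (fun t => n (x t) - n (x 0)) =o[𝓝 0] fun t => t - 0 := by
    have h4 := (h1.trans_isBigO h2).comp_tendsto hlim
    have h5 : (fun t => n (x t) - n (x 0)) =o[𝓝 0] fun t => x t - x 0 := by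
      refine h4.congr' (hσ'.mono fun t ht => ?_) (hσ'.mono fun t ht => ?_)
      · simp [ht, hx0]
      · simp [ht, hx0]
    exact h5.trans_isBigO hxd.hasFDerivAt.isBigO_sub
  have h6 : HasDerivAt (fun t => n (x t)) 0 0 := by
    rw [hasDerivAt_iff_isLittleO]
    simpa using h3
  have h7 : n (F (γ s)) = 0 := (n.hasFDerivAt.comp_hasDerivAt 0 hxd).unique h6
  have h8 : v.2 * (F (γ s)).1 = v.1 * (F (γ s)).2 := by
    simpa [hn, sub_eq_zero] using h7
  by_cases h9 : v.1 = 0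
  · have h10 : v.2 ≠ 0 := fun h' => hv0 (Prod.ext h9 h')
    refine ⟨(F (γ s)).2 / v.2, Prod.ext ?_ ?_⟩
    · rw [h9, zero_mul] at h8
      simpa [h9] using (mul_eq_zero.1 h8).resolve_left h10
    · simp [h10]
  · refine ⟨(F (γ s)).1 / v.1, Prod.ext ?_ ?_⟩
    · simp [h9]
    · simp only [Prod.smul_snd, smul_eq_mul]
      field_simp
      linarith

theorem exists_speed (h : IsCenterManifold F p 1 γ r) (hF : ContDiff ℝ 1 F) (hp : F p = 0) :
    ∃ (a : ℝ → ℝ) (C ρ : ℝ), 0 < ρ ∧ ρ ≤ r ∧ ContinuousOn a (Ioo (-r) r) ∧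
      (∀ s ∈ Ioo (-r) r, F (γ s) = a s • deriv γ s) ∧ ∀ s, |s| < ρ → |a s| ≤ C * |s| := by
  set q : ℝ × ℝ → ℝ := fun v => v.1 ^ 2 + v.2 ^ 2 with hq
  have hqpos : ∀ v : ℝ × ℝ, v ≠ 0 → 0 < q v := fun v hv => by
    by_contra! hle
    simp only [hq] at hle
    have h1 : v.1 = 0 := by nlinarith [sq_nonneg v.1, sq_nonneg v.2]
    have h2 : v.2 = 0 := by nlinarith [sq_nonneg v.1, sq_nonneg v.2]
    exact hv (Prod.ext h1 h2)
  -- Euclidean projection of the field onto the tangent gives an explicit, hence continuous, speed.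
  -- It is `O(s)` because `F ∘ γ` is differentiable with value `0` at `0`, and `γ'` stays away from
  -- zero.
  set a : ℝ → ℝ := fun s => ((F (γ s)).1 * (deriv γ s).1 + (F (γ s)).2 * (deriv γ s).2) /
    q (deriv γ s) with ha
  have hγc : ContinuousOn γ (Ioo (-r) r) := h.contDiffOn.continuousOn
  have hFγ : ContinuousOn (fun s => F (γ s)) (Ioo (-r) r) := hF.continuous.comp_continuousOn hγc
  have hd := h.continuousOn_deriv
  have hac : ContinuousOn a (Ioo (-r) r) := by
    refine ContinuousOn.div ?_ ?_ fun s hs => (hqpos _ (h.deriv_ne_zero s hs)).ne'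
    · exact (hFγ.fst.mul hd.fst).add (hFγ.snd.mul hd.snd)
    · exact (hd.fst.pow 2).add (hd.snd.pow 2)
  have haF : ∀ s ∈ Ioo (-r) r, F (γ s) = a s • deriv γ s := fun s hs => by
    obtain ⟨c, hc⟩ := h.exists_smul_deriv hF hs
    have hq0 := (hqpos _ (h.deriv_ne_zero s hs)).ne'
    have : a s = c := by
      simp only [ha, hc, Prod.smul_fst, Prod.smul_snd, smul_eq_mul]
      rw [div_eq_iff hq0]
      simp only [hq]; ring
    rw [this, hc]
  have h1 : (fun s => F (γ s)) =O[𝓝 0] fun s => s := by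
    have h2 : HasDerivAt (fun s => F (γ s)) _ 0 :=
      ((hF.differentiable (by simp)) (γ 0)).hasFDerivAt.comp_hasDerivAt 0 (h.hasDerivAt h.zero_mem)
    have := h2.hasFDerivAt.isBigO_sub
    simpa [h.through, hp] using this
  have h2 : a =O[𝓝 0] fun s => s := by
    have h3 : (fun s => F (γ s)) =ᶠ[𝓝 0] fun s => a s • deriv γ s := by
      filter_upwards [Ioo_mem_nhds h.zero_mem.1 h.zero_mem.2] with s hs using haF s hs
    have h4 : ∀ᶠ s in 𝓝 0, ‖deriv γ 0‖ / 2 < ‖deriv γ s‖ :=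
      ((hd.continuousAt (Ioo_mem_nhds h.zero_mem.1 h.zero_mem.2)).norm).eventually_const_lt
        (half_lt_self (norm_pos_iff.2 (h.deriv_ne_zero 0 h.zero_mem)))
    have h5 : a =O[𝓝 0] fun s => a s • deriv γ s := by
      refine Asymptotics.IsBigO.of_bound (‖deriv γ 0‖ / 2)⁻¹ ?_
      filter_upwards [h4] with s hs
      have hpos : 0 < ‖deriv γ 0‖ / 2 := half_pos (norm_pos_iff.2 (h.deriv_ne_zero 0 h.zero_mem))
      rw [norm_smul, le_inv_mul_iff₀ hpos, mul_comm]
      exact mul_le_mul_of_nonneg_left hs.le (norm_nonneg _)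
    exact h5.trans (h1.congr' h3 EventuallyEq.rfl)
  obtain ⟨C, hC⟩ := h2.bound
  obtain ⟨ρ, hρ, hball⟩ := Metric.eventually_nhds_iff.1 hC
  refine ⟨a, C, min ρ r, lt_min hρ h.pos, min_le_right _ _, hac, haF, fun s hs => ?_⟩
  simpa using hball (y := s) (by simpa using hs.trans_le (min_le_left _ _))

end IsCenterManifold

/-- Zeros of the speed are zeros of the field, and injectivity of `β` transfers the finiteness of
`Z` to their parameters. They therefore cannot accumulate at `0`, and shrinking `ρ` leaves a speed
without zeros. -/
theorem IsInvariantBranch.converges_or_diverges_of_finite {F : ℝ × ℝ → ℝ × ℝ} {p : ℝ × ℝ}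
    {β β' : ℝ → ℝ × ℝ} {r : ℝ} {a : ℝ → ℝ} {C ρ : ℝ} (h : IsInvariantBranch F p β β' r a C ρ)
    (hF : ContDiff ℝ 1 F) (hne : ∀ s ∈ Ioo 0 r, β s ≠ p) (hinj : InjOn β (Ioo 0 r))
    {Z : Set (ℝ × ℝ)} (hZ : Z.Finite) (hZF : ∀ s ∈ Ioo 0 r, F (β s) = 0 → β s ∈ Z) :
    BranchConverges F p β r ∨ BranchDiverges F p β r := by
  have hfin : {s ∈ Ioo 0 r | F (β s) = 0}.Finite := by
    refine Finite.of_finite_image (hZ.subset ?_) (hinj.mono (sep_subset _ _))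
    rintro _ ⟨s, hs, rfl⟩
    exact hZF s hs.1 hs.2
  have hev : ∀ᶠ s in 𝓝 (0 : ℝ), s ∉ {s ∈ Ioo 0 r | F (β s) = 0} :=
    hfin.isClosed.isOpen_compl.mem_nhds fun h0 => lt_irrefl _ h0.1.1
  obtain ⟨e, he, hball⟩ := Metric.eventually_nhds_iff.1 hev
  refine (h.mono (lt_min he h.pos) (min_le_right _ _)).converges_or_diverges (fun s hs ha => ?_) hF hne
  have hsr : s ∈ Ioo 0 r := ⟨hs.1, hs.2.trans_le ((min_le_right _ _).trans h.le)⟩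
  refine hball (y := s) ?_ ⟨hsr, by rw [h.field_eq s hsr, ha, zero_smul]⟩
  rw [Real.dist_0_eq_abs, abs_of_pos hs.1]
  exact hs.2.trans_le (min_le_left _ _)

namespace IsCenterManifold

variable {F : ℝ × ℝ → ℝ × ℝ} {p : ℝ × ℝ} {γ : ℝ → ℝ × ℝ} {r C ρ : ℝ} {a : ℝ → ℝ}

theorem continuousAt_zero (h : IsCenterManifold F p 1 γ r) : Tendsto γ (𝓝 0) (𝓝 p) := by
  have := (h.hasDerivAt h.zero_mem).continuousAt.tendsto
  rwa [h.through] at this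

theorem ne_point (h : IsCenterManifold F p 1 γ r) {s : ℝ} (hs : s ∈ Ioo (-r) r) (h0 : s ≠ 0) :
    γ s ≠ p := fun he => h0 (h.injOn hs h.zero_mem (he.trans h.through.symm))

theorem right_branch (h : IsCenterManifold F p 1 γ r) (hρ : 0 < ρ) (hρr : ρ ≤ r)
    (hac : ContinuousOn a (Ioo (-r) r)) (haF : ∀ s ∈ Ioo (-r) r, F (γ s) = a s • deriv γ s)
    (haC : ∀ s, |s| < ρ → |a s| ≤ C * |s|) : IsInvariantBranch F p γ (deriv γ) r a C ρ := by
  have hsub : Ioo 0 r ⊆ Ioo (-r) r := Ioo_subset_Ioo_left h.zero_mem.1.le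
  exact ⟨hρ, hρr, fun s hs => h.hasDerivAt (hsub hs), fun s hs => haF s (hsub hs), hac.mono hsub,
    fun s hs => by simpa [abs_of_pos hs.1] using haC s (by rw [abs_of_pos hs.1]; exact hs.2),
    h.continuousAt_zero.mono_left nhdsWithin_le_nhds⟩

theorem left_branch (h : IsCenterManifold F p 1 γ r) (hρ : 0 < ρ) (hρr : ρ ≤ r)
    (hac : ContinuousOn a (Ioo (-r) r)) (haF : ∀ s ∈ Ioo (-r) r, F (γ s) = a s • deriv γ s)
    (haC : ∀ s, |s| < ρ → |a s| ≤ C * |s|) :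
    IsInvariantBranch F p (fun s => γ (-s)) (fun s => -deriv γ (-s)) r (fun s => -a (-s)) C ρ := by
  have hsub : ∀ s ∈ Ioo 0 r, -s ∈ Ioo (-r) r := fun s hs =>
    ⟨neg_lt_neg hs.2, by linarith [hs.1, hs.2]⟩
  refine ⟨hρ, hρr, fun s hs => ?_, fun s hs => ?_, ?_, fun s hs => ?_, ?_⟩
  · simpa [Function.comp_def] using (h.hasDerivAt (hsub s hs)).scomp s (hasDerivAt_neg s)
  · rw [neg_smul_neg]; exact haF _ (hsub s hs)
  · exact (hac.comp continuousOn_neg hsub).neg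
  · have := haC (-s) (by rw [abs_neg, abs_of_pos hs.1]; exact hs.2)
    rwa [abs_neg, abs_of_pos hs.1, ← abs_neg (a (-s))] at this
  · have h1 : Tendsto (fun s : ℝ => -s) (𝓝 0) (𝓝 0) := by simpa using tendsto_neg (0 : ℝ)
    exact (h.continuousAt_zero.comp h1).mono_left nhdsWithin_le_nhds

theorem branch_dichotomy (h : IsCenterManifold F p 1 γ r) (hF : ContDiff ℝ 1 F) (hp : F p = 0)
    {Q : Set (ℝ × ℝ)} (hQ : {q ∈ Q | F q = 0}.Finite) :
    (γ '' Ioo 0 r ⊆ Q → BranchConverges F p γ r ∨ BranchDiverges F p γ r) ∧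
    (γ '' Ioo (-r) 0 ⊆ Q →
      BranchConverges F p (fun s => γ (-s)) r ∨ BranchDiverges F p (fun s => γ (-s)) r) := by
  obtain ⟨a, C, ρ, hρ, hρr, hac, haF, haC⟩ := h.exists_speed hF hp
  have hsub : Ioo 0 r ⊆ Ioo (-r) r := Ioo_subset_Ioo_left h.zero_mem.1.le
  have hsub' : ∀ s ∈ Ioo 0 r, -s ∈ Ioo (-r) r := fun s hs =>
    ⟨neg_lt_neg hs.2, by linarith [hs.1, hs.2]⟩
  refine ⟨fun hsq => ?_, fun hsq => ?_⟩
  · exact (h.right_branch hρ hρr hac haF haC).converges_or_diverges_of_finite hF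
      (fun s hs => h.ne_point (hsub hs) hs.1.ne') (h.injOn.mono hsub) hQ
      fun s hs h0 => ⟨hsq (mem_image_of_mem _ hs), h0⟩
  · exact (h.left_branch hρ hρr hac haF haC).converges_or_diverges_of_finite hF
      (fun s hs => h.ne_point (hsub' s hs) (neg_ne_zero.2 hs.1.ne'))
      (fun s hs t ht e => neg_injective (h.injOn (hsub' s hs) (hsub' t ht) e)) hQ
      fun s hs h0 => ⟨hsq (mem_image_of_mem _ ⟨neg_lt_neg hs.2, neg_lt_zero.2 hs.1⟩), h0⟩

/-- If the component of the field along a covector `l`, not annihilating the tangent, is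
asymptotic to `q s²` with `q ≠ 0`, then one branch converges and the other one diverges. -/
theorem converges_and_diverges (h : IsCenterManifold F p 1 γ r) (hF : ContDiff ℝ 1 F) (hp : F p = 0)
    (l : ℝ × ℝ →L[ℝ] ℝ) {q : ℝ} (hq : q ≠ 0) (hl : l (deriv γ 0) ≠ 0)
    (hlim : Tendsto (fun s => l (F (γ s)) / s ^ 2) (𝓝[≠] 0) (𝓝 q)) :
    (BranchConverges F p γ r ∧ BranchDiverges F p (fun s => γ (-s)) r) ∨
    (BranchDiverges F p γ r ∧ BranchConverges F p (fun s => γ (-s)) r) := by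
  obtain ⟨a, C, ρ, hρ, hρr, hac, haF, haC⟩ := h.exists_speed hF hp
  have hsub : Ioo 0 r ⊆ Ioo (-r) r := Ioo_subset_Ioo_left h.zero_mem.1.le
  have hsub' : ∀ s ∈ Ioo 0 r, -s ∈ Ioo (-r) r := fun s hs =>
    ⟨neg_lt_neg hs.2, by linarith [hs.1, hs.2]⟩
  have hnhds := Ioo_mem_nhds h.zero_mem.1 h.zero_mem.2
  have hlc : Tendsto (fun s => l (deriv γ s)) (𝓝[≠] 0) (𝓝 (l (deriv γ 0))) :=
    ((l.continuous.tendsto _).comp (h.continuousOn_deriv.continuousAt hnhds)).mono_left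
      nhdsWithin_le_nhds
  -- The limit is two-sided, so `a` keeps one sign on both sides of `0`; the speed `-a(-s)` of the
  -- reversed branch has the opposite sign.
  have ha : Tendsto (fun s => a s / s ^ 2) (𝓝[≠] 0) (𝓝 (q / l (deriv γ 0))) := by
    refine (hlim.div hlc hl).congr' ?_
    filter_upwards [hlc.eventually_ne hl, mem_nhdsWithin_of_mem_nhds hnhds, self_mem_nhdsWithin]
      with s hs1 hs2 hs3
    have hs3' : s ≠ 0 := hs3
    rw [Pi.div_apply, haF s hs2, map_smul, smul_eq_mul]
    field_simp
  have hc : q / l (deriv γ 0) ≠ 0 := div_ne_zero hq hl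
  have key : ∀ {P : ℝ → Prop}, (∀ᶠ s in 𝓝[≠] (0 : ℝ), P s) →
      ∃ ρ' > 0, ρ' ≤ ρ ∧ ∀ s ∈ Ioo 0 ρ', P s ∧ P (-s) := by
    intro P hP
    obtain ⟨e, he, hball⟩ := Metric.eventually_nhds_iff.1 (eventually_nhdsWithin_iff.1 hP)
    refine ⟨min e ρ, lt_min he hρ, min_le_right _ _, fun s hs => ⟨hball ?_ hs.1.ne', hball ?_ ?_⟩⟩
    · rw [Real.dist_0_eq_abs, abs_of_pos hs.1]; exact hs.2.trans_le (min_le_left _ _)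
    · rw [Real.dist_0_eq_abs, abs_neg, abs_of_pos hs.1]; exact hs.2.trans_le (min_le_left _ _)
    · exact neg_ne_zero.2 hs.1.ne'
  rcases hc.lt_or_gt with hneg | hpos
  · left
    obtain ⟨ρ', hρ', hρρ', hs⟩ := key (ha.eventually_lt_const hneg)
    have hneg' : ∀ s, s ≠ 0 → a s / s ^ 2 < 0 → a s < 0 := fun s h0 hlt => by
      have := mul_neg_of_neg_of_pos hlt (show 0 < s ^ 2 by positivity)
      rwa [div_mul_cancel₀ _ (pow_ne_zero 2 h0)] at this
    exact ⟨((h.right_branch hρ hρr hac haF haC).mono hρ' hρρ').branchConverges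
        fun s hs' => hneg' s hs'.1.ne' (hs s hs').1,
      ((h.left_branch hρ hρr hac haF haC).mono hρ' hρρ').branchDiverges
        (fun s hs' => neg_pos.2 (hneg' _ (neg_ne_zero.2 hs'.1.ne') (hs s hs').2)) hF
        (fun s hs => h.ne_point (hsub' s hs) (neg_ne_zero.2 hs.1.ne'))⟩
  · right
    obtain ⟨ρ', hρ', hρρ', hs⟩ := key (ha.eventually_const_lt hpos)
    have hpos' : ∀ s, s ≠ 0 → 0 < a s / s ^ 2 → 0 < a s := fun s h0 hlt => by
      have := mul_pos hlt (show 0 < s ^ 2 by positivity)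
      rwa [div_mul_cancel₀ _ (pow_ne_zero 2 h0)] at this
    exact ⟨((h.right_branch hρ hρr hac haF haC).mono hρ' hρρ').branchDiverges
        (fun s hs' => hpos' s hs'.1.ne' (hs s hs').1) hF
        (fun s hs => h.ne_point (hsub hs) hs.1.ne'),
      ((h.left_branch hρ hρr hac haF haC).mono hρ' hρρ').branchConverges
        fun s hs' => neg_lt_zero.2 (hpos' _ (neg_ne_zero.2 hs'.1.ne') (hs s hs').2)⟩

end IsCenterManifold

/-! ### Nondegenerate fixed points of saddle-node type -/

/-- Second-order expansion of `f` along a differentiable curve. -/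
theorem tendsto_second_order_comp {f c : ℝ → ℝ} {c' : ℝ} (hf : ContDiff ℝ 2 f)
    (hc : HasDerivAt c c' 0) :
    Tendsto (fun s => (f (c s) - f (c 0) - deriv f (c 0) * (c s - c 0)) / s ^ 2) (𝓝[≠] 0)
      (𝓝 (deriv (deriv f) (c 0) / 2 * c' ^ 2)) := by
  have hslope : Tendsto (fun s => (c s - c 0) / s) (𝓝[≠] 0) (𝓝 c') := by
    have := hasDerivAt_iff_tendsto_slope.1 hc
    refine this.congr fun s => ?_
    rw [slope_def_field, sub_zero]
  have h1 := taylor_isLittleO_univ (x₀ := c 0) (n := 2) hf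
  have h2 : (fun s => f (c s) - taylorWithinEval f 2 univ (c 0) (c s)) =o[𝓝[≠] 0] fun s => s ^ 2 := by
    refine (h1.comp_tendsto (hc.continuousAt.tendsto.mono_left nhdsWithin_le_nhds)).trans_isBigO ?_
    have h3 : (fun s => c s - c 0) =O[𝓝 0] fun s => s := by simpa using hc.hasFDerivAt.isBigO_sub
    exact (h3.mono nhdsWithin_le_nhds).pow 2
  have h4 := h2.tendsto_div_nhds_zero.add ((hslope.pow 2).const_mul (deriv (deriv f) (c 0) / 2))
  rw [zero_add] at h4
  refine h4.congr' ?_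
  filter_upwards [self_mem_nhdsWithin] with s hs
  have hs' : s ≠ 0 := hs
  simp only [taylorWithinEval_succ, taylor_within_zero_eval, iteratedDerivWithin_univ,
    iteratedDeriv_succ, iteratedDeriv_zero]
  simp
  field_simp
  ring

theorem platformField_converges_and_diverges {V W : ℝ → ℝ} {ε δ b g : ℝ} (hε : 0 < ε) (hδ : 0 < δ)
    (hV : ContDiff ℝ ∞ V) (hW : ContDiff ℝ ∞ W) (hp : platformField V W ε δ (b, g) = 0)
    (hD : deriv V g * deriv W b = ε * δ)
    (hnd : deriv (deriv V) g * deriv W b + 1 / ε * deriv V g ^ 2 * deriv (deriv W) b ≠ 0)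
    {γ : ℝ → ℝ × ℝ} {r : ℝ} (h : IsCenterManifold (platformField V W ε δ) (b, g) 1 γ r) :
    (BranchConverges (platformField V W ε δ) (b, g) γ r ∧
      BranchDiverges (platformField V W ε δ) (b, g) (fun s => γ (-s)) r) ∨
    (BranchDiverges (platformField V W ε δ) (b, g) γ r ∧
      BranchConverges (platformField V W ε δ) (b, g) (fun s => γ (-s)) r) := by
  have htan := h.tangent
  rw [centerSubspace_eq_span (linearization_platformField hV hW b g) hε hδ hD] at htan
  obtain ⟨k, hk⟩ : ∃ k : ℝ, k • (deriv V g, ε) = deriv γ 0 :=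
    Submodule.mem_span_singleton.1 (htan ▸ Submodule.mem_span_singleton_self _)
  have hk0 : k ≠ 0 := by
    rintro rfl
    exact h.deriv_ne_zero 0 h.zero_mem (by rw [← hk, zero_smul])
  have hγ := h.hasDerivAt h.zero_mem
  rw [← hk] at hγ
  have hγ1 : HasDerivAt (fun s => (γ s).1) (k * deriv V g) 0 := by
    simpa [Function.comp_def] using (hasFDerivAt_fst (𝕜 := ℝ) (p := γ 0)).comp_hasDerivAt 0 hγ
  have hγ2 : HasDerivAt (fun s => (γ s).2) (k * ε) 0 := by
    simpa [Function.comp_def] using (hasFDerivAt_snd (𝕜 := ℝ) (p := γ 0)).comp_hasDerivAt 0 hγ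
  have h1 := tendsto_second_order_comp (contDiff_infty.1 hW 2) hγ1
  have h2 := tendsto_second_order_comp (contDiff_infty.1 hV 2) hγ2
  simp only [h.through] at h1 h2
  -- A left null vector of the linearization, by `hD`: the linear part disappears from `l(F(γ(s)))`,
  -- leaving the second-order remainders of `V` and `W`.
  set l : ℝ × ℝ →L[ℝ] ℝ := deriv W b • ContinuousLinearMap.fst ℝ ℝ ℝ +
    ε • ContinuousLinearMap.snd ℝ ℝ ℝ with hl
  have hlim := (h2.const_mul (deriv W b)).add (h1.const_mul ε)
  refine h.converges_and_diverges (contDiff_infty.1 (contDiff_platformField hV hW) 1) hp l ?_ ?_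
    (hlim.congr fun s => ?_)
  · have e : deriv W b * (deriv (deriv V) g / 2 * (k * ε) ^ 2) +
        ε * (deriv (deriv W) b / 2 * (k * deriv V g) ^ 2) = (k * ε) ^ 2 / 2 *
        (deriv (deriv V) g * deriv W b + 1 / ε * deriv V g ^ 2 * deriv (deriv W) b) := by
      field_simp
    rw [e]
    exact mul_ne_zero (by positivity) hnd
  · rw [← hk]
    have e : l (k • (deriv V g, ε)) = k * (ε * (ε + δ)) := by
      simp [hl]; linear_combination k * hD
    rw [e]
    exact mul_ne_zero hk0 (by positivity)
  · simp only [platformField, Prod.mk_eq_zero] at hp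
    have e : l (platformField V W ε δ (γ s)) =
        deriv W b * (V (γ s).2 - V g - deriv V g * ((γ s).2 - g)) +
        ε * (W (γ s).1 - W b - deriv W b * ((γ s).1 - b)) := by
      simp [hl, platformField]
      linear_combination deriv W b * hp.1 + ε * hp.2 + ((γ s).2 - g) * hD
    rw [e]
    ring

/-! ### Existence of center manifolds -/

/-- Cut-off of the identity. -/
theorem exists_smooth_cutoff_id : ∃ θ : ℝ → ℝ, ContDiff ℝ ∞ θ ∧ (∀ x, |x| ≤ 1 → θ x = x) ∧
    (∀ x, |θ x| ≤ 2) ∧ ∀ n : ℕ, ∃ D, ∀ i ≤ n, ∀ x, |iteratedDeriv i θ x| ≤ D := by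
  let χ : ContDiffBump (0 : ℝ) := ⟨1, 2, one_pos, one_lt_two⟩
  have hsm : ContDiff ℝ ∞ fun x => χ x * x := χ.contDiff.mul contDiff_id
  have hsupp : HasCompactSupport fun x => χ x * x := χ.hasCompactSupport.mul_right
  refine ⟨fun x => χ x * x, hsm, fun x hx => ?_, fun x => ?_, fun n => ?_⟩
  · beta_reduce
    rw [χ.one_of_mem_closedBall (by simpa using hx), one_mul]
  · beta_reduce
    rcases le_or_gt |x| 2 with hx | hx
    · rw [abs_mul, abs_of_nonneg χ.nonneg]
      exact (mul_le_of_le_one_left (abs_nonneg x) χ.le_one).trans hx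
    · rw [χ.zero_of_le_dist (by simpa using hx.le)]
      simp
  · have : ∀ i : ℕ, ∃ D, ∀ x, |iteratedDeriv i (fun x => χ x * x) x| ≤ D := fun i => by
      obtain ⟨D, hD⟩ := (hsupp.iteratedFDeriv (𝕜 := ℝ) i).exists_bound_of_continuous
        (hsm.continuous_iteratedFDeriv (by exact_mod_cast le_top))
      exact ⟨D, fun x => by
        rw [← Real.norm_eq_abs, ← norm_iteratedFDeriv_eq_norm_iteratedDeriv]; exact hD x⟩
    choose D hD using this
    refine ⟨∑ i ∈ Finset.range (n + 1), D i, fun i hi x => (hD i x).trans ?_⟩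
    exact Finset.single_le_sum (f := D) (fun j _ => (abs_nonneg _).trans (hD j 0))
      (Finset.mem_range.2 (by omega))

theorem abs_le_of_abs_deriv_le {f : ℝ → ℝ} (hf : Differentiable ℝ f) (h0 : f 0 = 0) {z L : ℝ}
    (hL : ∀ y, |y| ≤ |z| → |deriv f y| ≤ L) : |f z| ≤ L * |z| := by
  have := (convex_Icc (-|z|) |z|).norm_image_sub_le_of_norm_deriv_le (f := f) (C := L)
    (fun y _ => hf y) (fun y hy => hL y (abs_le.2 hy)) (x := 0) (y := z)
    ⟨neg_nonpos.2 (abs_nonneg z), abs_nonneg z⟩ (abs_le.1 le_rfl)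
  simpa [h0] using this

/-- The rescaled, cut-off remainder `R(s θ(x)) / s` is small with its derivatives. -/
theorem exists_bddDerivs_rescaled {R θ : ℝ → ℝ} (hR : ContDiff ℝ ∞ R) (hR0 : R 0 = 0)
    (hR1 : deriv R 0 = 0) (hθ : ContDiff ℝ ∞ θ) (hθ2 : ∀ x, |θ x| ≤ 2) {n : ℕ} {D : ℝ}
    (hD : ∀ i ≤ n, ∀ x, |iteratedDeriv i θ x| ≤ D) {η : ℝ} (hη : 0 < η) :
    ∃ s₀ > 0, ∀ s, 0 < s → s ≤ s₀ → BddDerivs n η (fun x => s⁻¹ * R (s * θ x)) := by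
  obtain ⟨M, hM, hcomp⟩ := BddDerivs.exists_comp n D
  -- The second derivative is needed even for small `n`, to bound `R` quadratically at `0`.
  have hB : ∃ B, ∀ i ≤ n + 2, ∀ y ∈ Icc (-2 : ℝ) 2, |iteratedDeriv i R y| ≤ B := by
    have : ∀ i : ℕ, ∃ B, ∀ y ∈ Icc (-2 : ℝ) 2, |iteratedDeriv i R y| ≤ B := fun i =>
      isCompact_Icc.exists_bound_of_continuousOn
        (hR.continuous_iteratedDeriv i (by exact_mod_cast le_top)).continuousOn
    choose B hB using this
    refine ⟨∑ i ∈ Finset.range (n + 3), B i, fun i hi y hy => (hB i y hy).trans ?_⟩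
    exact Finset.single_le_sum (f := B) (fun j _ => (abs_nonneg _).trans (hB j 0 (by norm_num)))
      (Finset.mem_range.2 (by omega))
  obtain ⟨B, hB⟩ := hB
  have hB0 : 0 ≤ B := (abs_nonneg _).trans (hB 0 (by omega) 0 (by norm_num))
  have hdR : ContDiff ℝ ∞ (deriv R) := contDiff_infty_iff_deriv.1 hR |>.2
  have hR1b : ∀ z, |z| ≤ 2 → |deriv R z| ≤ B * |z| := fun z hz =>
    abs_le_of_abs_deriv_le (hdR.differentiable (by simp)) hR1 fun y hy => by
      have := hB 2 (by omega) y (abs_le.1 (hy.trans hz))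
      rwa [iteratedDeriv_succ, iteratedDeriv_one] at this
  have hR0b : ∀ z, |z| ≤ 2 → |R z| ≤ B * |z| * |z| := fun z hz =>
    abs_le_of_abs_deriv_le (hR.differentiable (by simp)) hR0 fun y hy =>
      (hR1b y (hy.trans hz)).trans (mul_le_mul_of_nonneg_left hy hB0)
  refine ⟨min 1 (η / (M * (4 * B) + 1)), by positivity, fun s hs hs₀ => ?_⟩
  have hs1 : s ≤ 1 := hs₀.trans (min_le_left _ _)
  have hRs : ContDiff ℝ ∞ fun y => s⁻¹ * R (s * y) :=
    contDiff_const.mul (hR.comp (contDiff_const.mul contDiff_id))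
  -- Derivative of order `0` costs `s⁻¹ B (2s)²`, order one `2Bs`, and order `i ≥ 2` costs `s ^ (i -
  -- 1) B`; for `s ≤ 1` all are at most `4Bs`.
  refine (hcomp (4 * B * s) (fun y => s⁻¹ * R (s * y)) θ (contDiff_infty.1 hRs n)
    (contDiff_infty.1 hθ n) (fun i hi x => ?_) fun i _ hi x => hD i hi x).of_le le_rfl ?_
  · have hsθ : |s * θ x| ≤ 2 * s := by
      rw [abs_mul, abs_of_pos hs, mul_comm]
      exact mul_le_mul_of_nonneg_right (hθ2 x) hs.le
    have hsθ2 : |s * θ x| ≤ 2 := hsθ.trans (by linarith)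
    rw [iteratedDeriv_const_mul_field, iteratedDeriv_comp_const_mul (contDiff_infty.1 hR i), abs_mul,
      abs_mul, abs_of_pos (inv_pos.2 hs), abs_of_pos (pow_pos hs i), inv_mul_le_iff₀ hs]
    rcases i with _ | _ | i
    · simp only [iteratedDeriv_zero, pow_zero, one_mul]
      calc _ ≤ B * |s * θ x| * |s * θ x| := hR0b _ hsθ2
        _ ≤ B * (2 * s) * (2 * s) := by gcongr
        _ = _ := by ring
    · simp only [zero_add, iteratedDeriv_one, pow_one]
      refine mul_le_mul_of_nonneg_left ?_ hs.le
      calc _ ≤ B * |s * θ x| := hR1b _ hsθ2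
        _ ≤ B * (2 * s) := by gcongr
        _ ≤ _ := by nlinarith
    · have h1 : s ^ (i + 1 + 1) ≤ s * s := by
        rw [pow_succ, pow_succ, mul_assoc]
        exact mul_le_of_le_one_left (by positivity) (pow_le_one₀ hs.le hs1)
      have h2 := hB (i + 1 + 1) (by omega) _ (abs_le.1 hsθ2)
      calc _ ≤ s * s * B := mul_le_mul h1 h2 (abs_nonneg _) (by positivity)
        _ ≤ _ := by nlinarith [mul_nonneg (mul_nonneg hs.le hs.le) hB0]
  · have h1 : s ≤ η / (M * (4 * B) + 1) := hs₀.trans (min_le_right _ _)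
    rw [le_div_iff₀ (by positivity)] at h1
    linarith

theorem BddDerivs.const {n : ℕ} (c : ℝ) : BddDerivs n |c| (fun _ => c) := by
  refine ⟨contDiff_const, fun i _ x => ?_⟩
  rw [iteratedDeriv_const]
  split_ifs <;> simp

/-- The nonlinearities `c₁ v(p₁ u + q₁ y) + c₂ w(p₂ u + q₂ y)` are small if `v` and `w` are. -/
theorem exists_bddDerivs_ridge (K : ℕ) (c₁ c₂ p₁ q₁ p₂ q₂ : ℝ) {η : ℝ} (hη : 0 < η) :
    ∃ η' > 0, ∀ v w : ℝ → ℝ, BddDerivs (K + 1) η' v → BddDerivs (K + 1) η' w →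
      (∀ φ, BddDerivs (K + 1) 1 φ → BddDerivs (K + 1) η
        (fun u => c₁ * v (p₁ * u + q₁ * φ u) + c₂ * w (p₂ * u + q₂ * φ u))) ∧
      ∀ u y z, |c₁ * v (p₁ * u + q₁ * y) + c₂ * w (p₂ * u + q₂ * y) -
        (c₁ * v (p₁ * u + q₁ * z) + c₂ * w (p₂ * u + q₂ * z))| ≤ η * |y - z| := by
  have hcomp : ∀ p q : ℝ, ∃ M : ℝ, 0 ≤ M ∧ ∀ (η' : ℝ) (v φ : ℝ → ℝ), BddDerivs (K + 1) η' v →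
      BddDerivs (K + 1) 1 φ → BddDerivs (K + 1) (M * η') (fun u => v (p * u + q * φ u)) := by
    intro p q
    -- The inner function `p u + q φ(u)` may be unbounded, but its derivatives of order at least one
    -- are bounded by `|p| + |q|`.
    obtain ⟨M, hM, h⟩ := BddDerivs.exists_comp (K + 1) (|p| + |q| * 1)
    refine ⟨M, hM, fun η' v φ hv hφ => h η' v _ hv.1
      ((contDiff_const.mul contDiff_id).add (contDiff_const.mul hφ.1)) (fun i hi u => hv.2 i hi _) ?_⟩
    rintro (_ | i) hi1 hi u
    · omega
    · have hφ' := BddDerivs.succ_iff.1 hφ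
      have e : deriv (fun u => p * u + q * φ u) = fun u => p + q * deriv φ u := funext fun u => by
        have := ((hasDerivAt_id u).const_mul p).fun_add ((hφ'.1 u).hasDerivAt.const_mul q)
        simpa using this.deriv
      rw [iteratedDeriv_succ', e]
      exact ((BddDerivs.const p).add (hφ'.2.2.const_mul q)).2 i (by omega) u
  obtain ⟨M₁, hM₁, h₁⟩ := hcomp p₁ q₁
  obtain ⟨M₂, hM₂, h₂⟩ := hcomp p₂ q₂
  set N := |c₁| * (M₁ + |q₁|) + |c₂| * (M₂ + |q₂|) + 1 with hN
  have hNpos : 0 < N := by positivity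
  refine ⟨η / N, by positivity, fun v w hv hw => ⟨fun φ hφ => ?_, fun u y z => ?_⟩⟩
  · refine (((h₁ _ v φ hv hφ).const_mul c₁).add ((h₂ _ w φ hw hφ).const_mul c₂)).of_le le_rfl ?_
    calc _ = (|c₁| * M₁ + |c₂| * M₂) * (η / N) := by ring
      _ ≤ N * (η / N) := by
        refine mul_le_mul_of_nonneg_right ?_ (by positivity)
        have h3 : 0 ≤ |c₁| * |q₁| := by positivity
        have h4 : 0 ≤ |c₂| * |q₂| := by positivity
        rw [hN]; linarith
      _ = η := mul_div_cancel₀ _ hNpos.ne'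
  · have hlip : ∀ (c p q : ℝ) (f : ℝ → ℝ), BddDerivs (K + 1) (η / N) f →
        |c * f (p * u + q * y) - c * f (p * u + q * z)| ≤ |c| * |q| * (η / N) * |y - z| := by
      intro c p q f hf
      rw [← mul_sub, abs_mul]
      have := hf.lipschitz (p * u + q * y) (p * u + q * z)
      rw [add_sub_add_left_eq_sub, ← mul_sub, abs_mul] at this
      calc _ ≤ |c| * (η / N * (|q| * |y - z|)) := mul_le_mul_of_nonneg_left this (abs_nonneg c)
        _ = _ := by ring
    have h3 := hlip c₁ p₁ q₁ v hv
    have h4 := hlip c₂ p₂ q₂ w hw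
    rw [add_sub_add_comm]
    refine (abs_add_le _ _).trans ((add_le_add h3 h4).trans ?_)
    calc _ = (|c₁| * |q₁| + |c₂| * |q₂|) * (η / N) * |y - z| := by ring
      _ ≤ N * (η / N) * |y - z| := by
        refine mul_le_mul_of_nonneg_right (mul_le_mul_of_nonneg_right ?_ (by positivity))
          (abs_nonneg _)
        have h3 : 0 ≤ |c₁| * M₁ := by positivity
        have h4 : 0 ≤ |c₂| * M₂ := by positivity
        rw [hN]; linarith
      _ = _ := by rw [mul_div_cancel₀ _ hNpos.ne']

/-- A curve with a differentiable left inverse along which the field is a `C¹` multiple of the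
velocity is locally invariant. -/
theorem isCenterManifold_of_leftInverse {F : ℝ × ℝ → ℝ × ℝ} {p : ℝ × ℝ} {k : ℕ} {γ : ℝ → ℝ × ℝ}
    {r : ℝ} {a : ℝ → ℝ} {l : ℝ × ℝ → ℝ} (hF : ContDiff ℝ 1 F) (hk : 1 ≤ k) (hr : 0 < r)
    (hγ : ContDiff ℝ k γ) (ha : ContDiff ℝ 1 a) (hl : Differentiable ℝ l) (hlγ : ∀ s, l (γ s) = s)
    (hFγ : ∀ s ∈ Ioo (-r) r, F (γ s) = a s • deriv γ s) (h0 : γ 0 = p)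
    (htan : Submodule.span ℝ {deriv γ 0} = centerSubspace (linearization F p)) :
    IsCenterManifold F p k γ r := by
  have hγd : ∀ s, HasDerivAt γ (deriv γ s) s := fun s =>
    (hγ.differentiable (by exact_mod_cast (by omega : k ≠ 0)) s).hasDerivAt
  refine ⟨hr, hγ.contDiffOn, fun s _ hs => ?_, ?_, h0, htan, fun s hs x hx hx0 => ?_⟩
  · have h1 : HasDerivAt (fun s => l (γ s)) (fderiv ℝ l (γ s) (deriv γ s)) s :=
      (hl (γ s)).hasFDerivAt.comp_hasDerivAt s (hγd s)
    simp only [hlγ, hs, map_zero] at h1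
    exact zero_ne_one (h1.unique (hasDerivAt_id s))
  · refine IsEmbedding.of_comp (hγ.continuous.comp continuous_subtype_val) hl.continuous ?_
    have : l ∘ (Ioo (-r) r).domRestrict γ = Subtype.val := funext fun s => hlγ s
    rw [this]
    exact IsEmbedding.subtypeVal
  · obtain ⟨σ, hσ0, e, he, hσ⟩ :=
      (ha.contDiffAt (x := s)).exists_forall_mem_closedBall_exists_eq_forall_mem_Ioo_hasDerivAt₀ 0
    have hσd : ∀ᶠ t in 𝓝 0, HasDerivAt σ (a (σ t)) t := by
      filter_upwards [Ioo_mem_nhds (by linarith : 0 - e < 0) (by linarith : 0 < 0 + e)] with t ht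
      exact hσ t ht
    have hσc : Tendsto σ (𝓝 0) (𝓝 s) := hσ0 ▸ hσd.self_of_nhds.continuousAt.tendsto
    have hσm : ∀ᶠ t in 𝓝 0, σ t ∈ Ioo (-r) r := hσc.eventually (Ioo_mem_nhds hs.1 hs.2)
    obtain ⟨L, U, hU, hLip⟩ := (hF.contDiffAt (x := γ s)).exists_lipschitzOnWith
    have hxU : ∀ᶠ t in 𝓝 0, x t ∈ U := by
      have := hx.continuousAt.tendsto
      rw [hx0] at this
      exact this.eventually hU
    have hyU : ∀ᶠ t in 𝓝 0, γ (σ t) ∈ U := ((hγ.continuous.tendsto s).comp hσc).eventually hU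
    have heq : x =ᶠ[𝓝 0] fun t => γ (σ t) := by
      refine ODE_solution_unique_of_eventually (v := fun _ => F) (s := fun _ => U) (K := L)
        (Eventually.of_forall fun _ => hLip) ?_ ?_ (by rw [hx0, hσ0])
      · filter_upwards [hx, hxU] with t h1 h2 using ⟨h1, h2⟩
      · filter_upwards [hσd, hσm, hyU] with t h1 h2 h3
        refine ⟨?_, h3⟩
        rw [hFγ _ h2]
        exact (hγd (σ t)).scomp t h1
    filter_upwards [heq, hσm] with t h1 h2
    exact ⟨σ t, h2, h1.symm⟩

/-- The second-order Taylor remainder at `x₀`, as a function of the increment. -/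
theorem taylorRemainder_props {f : ℝ → ℝ} (hf : ContDiff ℝ ∞ f) (x₀ : ℝ) :
    ContDiff ℝ ∞ (fun z => f (x₀ + z) - f x₀ - deriv f x₀ * z) ∧
      HasDerivAt (fun z => f (x₀ + z) - f x₀ - deriv f x₀ * z) 0 0 := by
  refine ⟨((hf.comp (contDiff_const.add contDiff_id)).sub contDiff_const).sub
    (contDiff_const.mul contDiff_id), ?_⟩
  have h1 : HasDerivAt (fun z => f (x₀ + z)) (deriv f x₀) 0 :=
    HasDerivAt.comp_const_add x₀ 0 (by
      rw [add_zero]; exact (hf.differentiable (by simp) x₀).hasDerivAt)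
  have := (h1.sub_const (f x₀)).fun_sub ((hasDerivAt_id (0 : ℝ)).const_mul (deriv f x₀))
  simpa using this

/-- Makes the invariant graph tangent to the center direction. As `φ'` may fail to be
differentiable, the product rule is replaced by `a φ' = o(u) O(1) = o(u)`; then `lam φ = h - a φ'`
has zero derivative at `0`. -/
theorem deriv_zero_of_invariant {a h φ : ℝ → ℝ} {lam C : ℝ} (hlam : lam ≠ 0)
    (hφ : Differentiable ℝ φ) (hφC : ∀ u, |deriv φ u| ≤ C) (ha0 : a 0 = 0) (ha : HasDerivAt a 0 0)
    (hh : HasDerivAt h 0 0) (heq : ∀ u, a u * deriv φ u + lam * φ u = h u) : deriv φ 0 = 0 := by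
  have h1 : HasDerivAt (fun u => a u * deriv φ u) 0 0 := by
    rw [hasDerivAt_iff_isLittleO] at ha ⊢
    simp only [ha0, sub_zero, smul_zero, zero_mul] at ha ⊢
    have h2 : deriv φ =O[𝓝 0] fun _ => (1 : ℝ) :=
      Asymptotics.IsBigO.of_bound C (Eventually.of_forall fun u => by simpa using hφC u)
    simpa using ha.mul_isBigO h2
  have h3 : HasDerivAt (fun u => h u - a u * deriv φ u) (0 - 0) 0 := hh.fun_sub h1
  have h4 : (fun u => h u - a u * deriv φ u) = fun u => lam * φ u := funext fun u => by
    rw [← heq u]; ring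
  rw [h4] at h3
  have := ((hφ 0).hasDerivAt.const_mul lam).unique h3
  simpa [hlam] using this

/-- Existence of center manifolds of every finite order of smoothness. -/
theorem exists_isCenterManifold {V W : ℝ → ℝ} {ε δ b g : ℝ} (hε : 1 ≤ ε) (hδ : 1 ≤ δ)
    (hV : ContDiff ℝ ∞ V) (hW : ContDiff ℝ ∞ W) (hp : platformField V W ε δ (b, g) = 0)
    (hD : deriv V g * deriv W b = ε * δ) {k : ℕ} (hk : 1 ≤ k) :
    ∃ (γ : ℝ → ℝ × ℝ) (r : ℝ), IsCenterManifold (platformField V W ε δ) (b, g) k γ r := by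
  have hε0 : 0 < ε := by linarith
  have hδ0 : 0 < δ := by linarith
  set α := deriv V g with hα
  set β := deriv W b with hβ
  set lam := ε + δ with hlam
  have hlam0 : 0 < lam := by positivity
  obtain ⟨η, hη, hgraph⟩ := exists_invariant_graph hk (show 1 ≤ lam by linarith)
  -- With `b + α (u + y)`, `g + ε u - δ y` as coordinates, `ε lam u = β Δb + ε Δg` and `δ lam y = β
  -- Δb - δ Δg`, where `Δb`, `Δg` are the deviations. These relations produce the coefficients of
  -- the remainders of `V` and `W` here and in the next line.
  obtain ⟨η₁, hη₁, hf⟩ := exists_bddDerivs_ridge k (β / (ε * lam)) (1 / lam) ε (-δ) α α hη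
  obtain ⟨η₂, hη₂, hh⟩ := exists_bddDerivs_ridge k (β / (δ * lam)) (-1 / lam) ε (-δ) α α hη
  obtain ⟨θ, hθ, hθ1, hθ2, hθD⟩ := exists_smooth_cutoff_id
  obtain ⟨D, hD'⟩ := hθD (k + 1)
  have hθ0 : θ 0 = 0 := hθ1 0 (by simp)
  have hη' : 0 < min η₁ η₂ := lt_min hη₁ hη₂
  obtain ⟨hRV, hRV1⟩ := taylorRemainder_props hV g
  obtain ⟨hRW, hRW1⟩ := taylorRemainder_props hW b
  rw [← hα] at hRV hRV1
  rw [← hβ] at hRW hRW1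
  set RV : ℝ → ℝ := fun z => V (g + z) - V g - α * z with hRVdef
  set RW : ℝ → ℝ := fun z => W (b + z) - W b - β * z with hRWdef
  have hRV0 : RV 0 = 0 := by simp [hRVdef]
  have hRW0 : RW 0 = 0 := by simp [hRWdef]
  obtain ⟨s₁, hs₁, hv⟩ := exists_bddDerivs_rescaled hRV hRV0 hRV1.deriv hθ hθ2 hD' hη'
  obtain ⟨s₂, hs₂, hw⟩ := exists_bddDerivs_rescaled hRW hRW0 hRW1.deriv hθ hθ2 hD' hη'
  set s := min s₁ s₂ with hs
  have hs0 : 0 < s := lt_min hs₁ hs₂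
  have hvB := hv s hs0 (min_le_left _ _)
  have hwB := hw s hs0 (min_le_right _ _)
  have hderiv0 : ∀ R : ℝ → ℝ, HasDerivAt R 0 0 → HasDerivAt (fun x => s⁻¹ * R (s * θ x)) 0 0 := by
    intro R hR
    have h1 := ((hθ.differentiable (by simp) 0).hasDerivAt).const_mul s
    have h2 : HasDerivAt R 0 (s * θ 0) := by rwa [hθ0, mul_zero]
    simpa using (h2.comp 0 h1).const_mul s⁻¹
  have hv1 := hderiv0 RV hRV1
  have hw1 := hderiv0 RW hRW1
  have hvθ : ∀ x, |x| ≤ 1 → RV (s * x) = s * (s⁻¹ * RV (s * θ x)) := fun x hx => by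
    rw [hθ1 x hx, mul_inv_cancel_left₀ hs0.ne']
  have hwθ : ∀ x, |x| ≤ 1 → RW (s * x) = s * (s⁻¹ * RW (s * θ x)) := fun x hx => by
    rw [hθ1 x hx, mul_inv_cancel_left₀ hs0.ne']
  set v : ℝ → ℝ := fun x => s⁻¹ * RV (s * θ x) with hvdef
  set w : ℝ → ℝ := fun x => s⁻¹ * RW (s * θ x) with hwdef
  have hv0 : v 0 = 0 := by simp only [hvdef, hθ0, mul_zero, hRV0]
  have hw0 : w 0 = 0 := by simp only [hwdef, hθ0, mul_zero, hRW0]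
  obtain ⟨hfB, hfL⟩ := hf v w (hvB.of_le le_rfl (min_le_left _ _)) (hwB.of_le le_rfl (min_le_left _ _))
  obtain ⟨hhB, hhL⟩ := hh v w (hvB.of_le le_rfl (min_le_right _ _))
    (hwB.of_le le_rfl (min_le_right _ _))
  obtain ⟨φ, hφB, hφ0, hφ⟩ := hgraph
    (fun u y => β / (ε * lam) * v (ε * u + -δ * y) + 1 / lam * w (α * u + α * y))
    (fun u y => β / (δ * lam) * v (ε * u + -δ * y) + -1 / lam * w (α * u + α * y))
    hfB hhB hfL hhL (by simp [hv0, hw0]) (by simp [hv0, hw0])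
  obtain ⟨m, rfl⟩ : ∃ m, k = m + 1 := ⟨k - 1, by omega⟩
  have hφd : ∀ u, HasDerivAt φ (deriv φ u) u := fun u =>
    ((BddDerivs.succ_iff.1 hφB).1 u).hasDerivAt
  set ξ : ℝ → ℝ := fun u => ε * u + -δ * φ u with hξ
  set ζ : ℝ → ℝ := fun u => α * u + α * φ u with hζ
  have hξd : ∀ u, HasDerivAt ξ (ε - δ * deriv φ u) u := fun u => by
    have := ((hasDerivAt_id u).const_mul ε).fun_add ((hφd u).const_mul (-δ))
    exact this.congr_deriv (by ring)
  have hζd : ∀ u, HasDerivAt ζ (α * (1 + deriv φ u)) u := fun u => by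
    have := ((hasDerivAt_id u).const_mul α).fun_add ((hφd u).const_mul α)
    exact this.congr_deriv (by ring)
  have hξ0 : ξ 0 = 0 := by simp [hξ, hφ0]
  have hζ0 : ζ 0 = 0 := by simp [hζ, hφ0]
  have hvξ : HasDerivAt (fun u => v (ξ u)) 0 0 := by
    simpa [Function.comp_def] using (show HasDerivAt v 0 (ξ 0) by rw [hξ0]; exact hv1).comp 0 (hξd 0)
  have hwζ : HasDerivAt (fun u => w (ζ u)) 0 0 := by
    simpa [Function.comp_def] using (show HasDerivAt w 0 (ζ 0) by rw [hζ0]; exact hw1).comp 0 (hζd 0)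
  have hcomb : ∀ c₁ c₂ : ℝ, HasDerivAt (fun u => c₁ * v (ξ u) + c₂ * w (ζ u)) 0 0 := fun c₁ c₂ => by
    simpa using (hvξ.const_mul c₁).fun_add (hwζ.const_mul c₂)
  have hφ'0 : deriv φ 0 = 0 :=
    deriv_zero_of_invariant (a := fun u => β / (ε * lam) * v (ξ u) + 1 / lam * w (ζ u))
      (h := fun u => β / (δ * lam) * v (ξ u) + -1 / lam * w (ζ u)) hlam0.ne'
      (BddDerivs.succ_iff.1 hφB).1 (fun u => (BddDerivs.succ_iff.1 hφB).2.2.abs_le u)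
      (by simp only [hξ0, hζ0, hv0, hw0, mul_zero, add_zero]) (hcomb _ _) (hcomb _ _) hφ
  set γ : ℝ → ℝ × ℝ := fun u => (b + s * ζ u, g + s * ξ u) with hγ
  have hγd : ∀ u, HasDerivAt γ (s * (α * (1 + deriv φ u)), s * (ε - δ * deriv φ u)) u := fun u =>
    (((hζd u).const_mul s).const_add b).prodMk (((hξd u).const_mul s).const_add g)
  have hξC : ContDiff ℝ ((m + 1 : ℕ) : WithTop ℕ∞) ξ :=
    (contDiff_const.mul contDiff_id).add (contDiff_const.mul hφB.1)
  have hζC : ContDiff ℝ ((m + 1 : ℕ) : WithTop ℕ∞) ζ :=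
    (contDiff_const.mul contDiff_id).add (contDiff_const.mul hφB.1)
  have hγC : ContDiff ℝ ((m + 1 : ℕ) : WithTop ℕ∞) γ :=
    (contDiff_const.add (contDiff_const.mul hζC)).prodMk
      (contDiff_const.add (contDiff_const.mul hξC))
  have h1m : (1 : WithTop ℕ∞) ≤ ((m + 1 : ℕ) : WithTop ℕ∞) := by exact_mod_cast hk
  have haC : ContDiff ℝ 1 fun u => β / (ε * lam) * v (ξ u) + 1 / lam * w (ζ u) := by
    have h1 : ContDiff ℝ 1 v := hvB.1.of_le (by exact_mod_cast (by omega : 1 ≤ m + 1 + 1))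
    have h2 : ContDiff ℝ 1 w := hwB.1.of_le (by exact_mod_cast (by omega : 1 ≤ m + 1 + 1))
    exact (contDiff_const.mul (h1.comp (hξC.of_le h1m))).add
      (contDiff_const.mul (h2.comp (hζC.of_le h1m)))
  have hξζ : ∀ᶠ u in 𝓝 (0 : ℝ), |ξ u| < 1 ∧ |ζ u| < 1 := by
    have h1 := (hξd 0).continuousAt.abs
    have h2 := (hζd 0).continuousAt.abs
    refine (h1.eventually_lt continuousAt_const ?_).and (h2.eventually_lt continuousAt_const ?_) <;>
      simp [hξ0, hζ0]
  -- For `|u| < r` both arguments lie where the cut-off is the identity, so the truncated and the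
  -- true fields agree on the arc.
  obtain ⟨r, hr, hball⟩ := Metric.eventually_nhds_iff.1 hξζ
  refine ⟨γ, r, isCenterManifold_of_leftInverse
    (a := fun u => β / (ε * lam) * v (ξ u) + 1 / lam * w (ζ u))
    -- The coordinate `u` itself, a linear left inverse of the graph parametrization up to the base
    -- point.
    (l := fun q => (β * (q.1 - b) + ε * (q.2 - g)) / (s * (ε * lam)))
    (contDiff_infty.1 (contDiff_platformField hV hW) 1) hk hr hγC haC (by fun_prop) (fun u => ?_)
    (fun u hu => ?_) (by simp [hγ, hξ0, hζ0]) ?_⟩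
  · simp only [hγ, hξ, hζ, add_sub_cancel_left]
    rw [div_eq_iff (by positivity), hlam]
    linear_combination (s * (u + φ u)) * hD
  · obtain ⟨hu1, hu2⟩ := hball (y := u) (by rw [Real.dist_0_eq_abs]; exact abs_lt.2 hu)
    have hV' : V (g + s * ξ u) = s * v (ξ u) + V g + α * (s * ξ u) := by
      rw [← hvθ _ hu1.le]; simp only [hRVdef]; ring
    have hW' : W (b + s * ζ u) = s * w (ζ u) + W b + β * (s * ζ u) := by
      rw [← hwθ _ hu2.le]; simp only [hRWdef]; ring
    simp only [platformField, Prod.mk_eq_zero] at hp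
    have hφu : (β / (ε * lam) * v (ξ u) + 1 / lam * w (ζ u)) * deriv φ u + lam * φ u =
      β / (δ * lam) * v (ξ u) + -1 / lam * w (ζ u) := hφ u
    rw [(hγd u).deriv]
    simp only [platformField, hγ, hV', hW', Prod.smul_mk, smul_eq_mul, Prod.mk.injEq]
    have hsum : α * (β / (ε * lam)) + α * (β / (δ * lam)) = 1 := by
      have : α * (β / (ε * lam)) + α * (β / (δ * lam)) = α * β * (ε + δ) / (ε * δ * lam) := by
        field_simp; ring
      rw [this, hD, hlam, div_self (by positivity)]
    have hdiff : ε * (β / (ε * lam)) = δ * (β / (δ * lam)) := by field_simp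
    have hone : ε * (1 / lam) + δ * (1 / lam) = 1 := by rw [hlam]; field_simp
    have hneg : -1 / lam = -(1 / lam) := by ring
    rw [hneg] at hφu
    generalize β / (ε * lam) = c₁ at *
    generalize β / (δ * lam) = c₃ at *
    generalize 1 / lam = c₂ at *
    generalize v (ξ u) = v' at *
    generalize w (ζ u) = w' at *
    simp only [hξ, hζ]
    constructor
    · linear_combination hp.1 - s * v' * hsum - s * α * hφu
    · linear_combination hp.2 - s * v' * hdiff - s * w' * hone + s * δ * hφu + s * (u + φ u) * hD
  · rw [centerSubspace_eq_span (linearization_platformField hV hW b g) hε0 hδ0 hD, (hγd 0).deriv, hφ'0,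
      ← hα]
    have : ((s * (α * (1 + 0)), s * (ε - δ * 0)) : ℝ × ℝ) = s • (α, ε) := by simp
    rw [this, Submodule.span_singleton_smul_eq (IsUnit.mk0 s hs0.ne')]

/-! ### Assembly of the theorem -/

theorem mul_deriv_eq_of_isCenterManifold {V W : ℝ → ℝ} {ε δ b g : ℝ} (hT : 0 < ε + δ)
    (hV : ContDiff ℝ ∞ V) (hW : ContDiff ℝ ∞ W) {k : ℕ} {γ : ℝ → ℝ × ℝ} {r : ℝ}
    (h : IsCenterManifold (platformField V W ε δ) (b, g) k γ r) :
    deriv V g * deriv W b = ε * δ := by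
  by_contra hD
  have htan := h.tangent
  rw [centerSubspace_eq_bot (linearization_platformField hV hW b g) hT hD,
    Submodule.span_singleton_eq_bot] at htan
  exact h.deriv_ne_zero 0 ⟨neg_lt_zero.2 h.pos, h.pos⟩ htan

theorem mainTheorem1 (V W : ℝ → ℝ) (ε δ : ℝ) (hε : 1 ≤ ε) (hδ : 1 ≤ δ)
    (hV : ContDiff ℝ ∞ V) (hW : ContDiff ℝ ∞ W)
    (hVmaps : MapsTo V (Icc 0 1) (Icc 0 1)) (hWmaps : MapsTo W (Icc 0 1) (Icc 0 1))
    (hV0 : V 0 = 0) (hW0 : W 0 = 0)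
    (hfin : (platformFixedPoints V W ε δ).Finite) :
    -- location of the fixed points
    platformFixedPoints V W ε δ =
      {p : ℝ × ℝ | p ∈ unitSquare ∧ ε * p.1 = V p.2 ∧ δ * p.2 = W p.1} ∧
    ∀ b₀ g₀ : ℝ, (b₀, g₀) ∈ platformFixedPoints V W ε δ →
      -- types of fixed points; none is repelling
      (IsStableNode (platformField V W ε δ) (b₀, g₀) ∨
        IsStableSpiral (platformField V W ε δ) (b₀, g₀) ∨
        IsSaddle (platformField V W ε δ) (b₀, g₀) ∨
        IsSaddleNodeType (platformField V W ε δ) (b₀, g₀)) ∧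
      ¬ IsRepelling (platformField V W ε δ) (b₀, g₀) ∧
      (∃ μ ∈ eigenvaluesAt (platformField V W ε δ) (b₀, g₀), μ.re < 0) ∧
      -- stable nodes and spirals
      ((IsStableNode (platformField V W ε δ) (b₀, g₀) ∨
          IsStableSpiral (platformField V W ε δ) (b₀, g₀)) ↔
        deriv V g₀ * deriv W b₀ < ε * δ) ∧
      -- saddles
      (IsSaddle (platformField V W ε δ) (b₀, g₀) ↔ deriv V g₀ * deriv W b₀ > ε * δ) ∧
      -- center manifolds of every finite order of smoothness
      (∀ k : ℕ, 1 ≤ k →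
        ((∃ (γ : ℝ → ℝ × ℝ) (r : ℝ),
            IsCenterManifold (platformField V W ε δ) (b₀, g₀) k γ r) ↔
          deriv V g₀ * deriv W b₀ = ε * δ)) ∧
      -- a branch of a center manifold that runs in the square converges or diverges
      (∀ (γ : ℝ → ℝ × ℝ) (r : ℝ),
        IsCenterManifold (platformField V W ε δ) (b₀, g₀) 1 γ r →
        (γ '' Ioo 0 r ⊆ unitSquare →
          BranchConverges (platformField V W ε δ) (b₀, g₀) γ r ∨
          BranchDiverges (platformField V W ε δ) (b₀, g₀) γ r) ∧
        (γ '' Ioo (-r) 0 ⊆ unitSquare →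
          BranchConverges (platformField V W ε δ) (b₀, g₀) (fun s => γ (-s)) r ∨
          BranchDiverges (platformField V W ε δ) (b₀, g₀) (fun s => γ (-s)) r)) ∧
      -- in the nondegenerate case one branch converges and the other one diverges
      (deriv V g₀ * deriv W b₀ = ε * δ →
        deriv (deriv V) g₀ * deriv W b₀ + 1 / ε * deriv V g₀ ^ 2 * deriv (deriv W) b₀ ≠ 0 →
        ∀ (γ : ℝ → ℝ × ℝ) (r : ℝ),
          IsCenterManifold (platformField V W ε δ) (b₀, g₀) 1 γ r →
          (BranchConverges (platformField V W ε δ) (b₀, g₀) γ r ∧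
            BranchDiverges (platformField V W ε δ) (b₀, g₀) (fun s => γ (-s)) r) ∨
          (BranchDiverges (platformField V W ε δ) (b₀, g₀) γ r ∧
            BranchConverges (platformField V W ε δ) (b₀, g₀) (fun s => γ (-s)) r)) := by
  refine ⟨platformFixedPoints_eq, fun b₀ g₀ hp => ?_⟩
  have hp0 : platformField V W ε δ (b₀, g₀) = 0 := by
    rw [platformFixedPoints_eq] at hp
    simp only [platformField, Prod.mk_eq_zero, sub_eq_zero]
    exact ⟨hp.2.1.symm, hp.2.2.symm⟩
  have hF : ContDiff ℝ 1 (platformField V W ε δ) := contDiff_infty.1 (contDiff_platformField hV hW) 1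
  obtain ⟨h1, h2, h3, h4, h5⟩ := platformField_classification hε hδ hV hW b₀ g₀
  refine ⟨h1, h2, h3, h4, h5, fun k hk => ⟨?_, fun hD => ?_⟩, fun γ r h => ?_, fun hD hnd γ r h => ?_⟩
  · rintro ⟨γ, r, h⟩
    exact mul_deriv_eq_of_isCenterManifold (by linarith) hV hW h
  · exact exists_isCenterManifold hε hδ hV hW hp0 hD hk
  · refine h.branch_dichotomy hF hp0 (hfin.subset ?_)
    rintro q ⟨hq, hq0⟩
    rw [platformFixedPoints_eq]
    simp only [platformField, Prod.mk_eq_zero, sub_eq_zero] at hq0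
    exact ⟨hq, hq0.1.symm, hq0.2.symm⟩
  · exact platformField_converges_and_diverges (by linarith) (by linarith) hV hW hp0 hD hnd h
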